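/- Let $R$ be an associative ring with identity; modules are left $R$-modules unless stated otherwise. A (left or right) module is super finitely presented if it has a projective resolution by finitely generated projective modules. A module $W$ is weak injective if $\operatorname{Ext}^1_R(F,W)=0$ for every super finitely presented left module $F$, and weak flat if $\operatorname{Tor}_1^R(F,W)=0$ for every super finitely presented right module $F$. A $\mathcal{WI}$-pure exact complex of injectives is an exact complex $\mathbf T$ of injective modules, indexed by $\mathbb Z$, such that $\operatorname{Hom}_R(W,\mathbf T)$ is exact for every weak injective $W$. A $\mathcal{WF}$-copure exact complex of projectives is an exact complex $\mathbf T$ of projective modules, indexed by $\mathbb Z$, such that $\operatorname{Hom}_R(\mathbf T,W)$ is exact for every weak flat $W$. A module is Gorenstein weak injective (resp. Gorenstein weak projective) if it is isomorphic to the cokernel of a differential of a $\mathcal{WI}$-pure exact complex of injectives (resp. of a $\mathcal{WF}$-copure exact complex of projectives). $Gwid_R(N)$ is the infimum of the $n$ for which there is an exact sequence $0\to N\to G^0\to\cdots\to G^n\to 0$ with all $G^i$ Gorenstein weak injective, and $Gwpd_R(M)$ is the infimum of the $n$ for which there is an exact sequence $0\to G_n\to\cdots\to G_0\to M\to 0$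 with all $G_i$ Gorenstein weak projective ($\infty$ if there is no such $n$). A $\mathcal{WI}$-pure Tate injective resolution of $N$ is a diagram $N\to\mathbf E\xrightarrow{u}\mathbf T$ in which $\mathbf E$ is a deleted injective resolution of $N$, $\mathbf T$ is a $\mathcal{WI}$-pure exact complex of injectives and $u$ is a morphism of complexes with $u^n$ an isomorphism for $n\gg0$; then $\widehat{\operatorname{Ext}}^i_{\mathcal{GWI}}(M,N)=\operatorname{H}^i(\operatorname{Hom}_R(M,\mathbf T))$. A $\mathcal{WF}$-copure Tate projective resolution of $M$ is a diagram $\mathbf T\xrightarrow{u}\mathbf P\to M$ in which $\mathbf P$ is a deleted projective resolution of $M$, $\mathbf T$ is a $\mathcal{WF}$-copure exact complex of projectives and $u$ is a morphism of complexes with $u_n$ an isomorphism for $n\gg0$; then $\widehat{\operatorname{Ext}}^i_{\mathcal{GWP}}(M,N)=\operatorname{H}^i(\operatorname{Hom}_R(\mathbf T,N))$. Theorem. Let $M$ and $N$ be $R$-modules with $Gwpd_R(M)<\infty$ and $Gwid_R(N)<\infty$. Then $M$ has a $\mathcal{WF}$-copure Tate projective resolution and $N$ has a $\mathcal{WI}$-pure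 Tate injective resolution, and for all such resolutions and every $i\in\mathbb Z$ there is an isomorphism of abelian groups $$\widehat{\operatorname{Ext}}^i_{\mathcal{GWP}}(M,N)\cong\widehat{\operatorname{Ext}}^i_{\mathcal{GWI}}(M,N).$$ -/

import Mathlib

open CategoryTheory CategoryTheory.Limits
open scoped TensorProduct

universe u

noncomputable section

namespace GorensteinWeak

/-! ## The tensor product of a right and a left module, and Tor -/

section Tensor

variable {R : Type u} [Ring R]

/-- The relations `n r ⊗ m = n ⊗ r m` in `N ⊗[ℤ] M`, for a right `R`-module `N` (a module over
`Rᵐᵒᵖ`) and a left `R`-module `M`. -/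
def balancing (N : Type u) [AddCommGroup N] [Module Rᵐᵒᵖ N]
    (M : Type u) [AddCommGroup M] [Module R M] : AddSubgroup (N ⊗[ℤ] M) :=
  AddSubgroup.closure
    {x | ∃ (n : N) (r : R) (m : M), x = (MulOpposite.op r • n) ⊗ₜ[ℤ] m - n ⊗ₜ[ℤ] (r • m)}

/-- The abelian group `N ⊗_R M`, for a right `R`-module `N` and a left `R`-module `M` over a
not necessarily commutative ring `R`. -/
abbrev BalancedTensor (N : Type u) [AddCommGroup N] [Module Rᵐᵒᵖ N]
    (M : Type u) [AddCommGroup M] [Module R M] : Type u :=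
  (N ⊗[ℤ] M) ⧸ balancing (R := R) N M

/-- The additive map `N ⊗[ℤ] M → N ⊗[ℤ] M'` induced by an `R`-linear map `M → M'`. -/
def preMap (N : Type u) [AddCommGroup N]
    {M M' : Type u} [AddCommGroup M] [Module R M] [AddCommGroup M'] [Module R M']
    (f : M →ₗ[R] M') : N ⊗[ℤ] M →+ N ⊗[ℤ] M' :=
  (LinearMap.lTensor N (f.toAddMonoidHom.toIntLinearMap)).toAddMonoidHom

@[simp]
theorem preMap_tmul (N : Type u) [AddCommGroup N]
    {M M' : Type u} [AddCommGroup M] [Module R M] [AddCommGroup M'] [Module R M']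
    (f : M →ₗ[R] M') (n : N) (m : M) :
    preMap N f (n ⊗ₜ[ℤ] m) = n ⊗ₜ[ℤ] f m := rfl

theorem balancing_le_comap (N : Type u) [AddCommGroup N] [Module Rᵐᵒᵖ N]
    {M M' : Type u} [AddCommGroup M] [Module R M] [AddCommGroup M'] [Module R M']
    (f : M →ₗ[R] M') :
    balancing (R := R) N M ≤ (balancing (R := R) N M').comap (preMap N f) := by
  refine (AddSubgroup.closure_le _).2 ?_
  rintro x ⟨n, r, m, rfl⟩
  refine AddSubgroup.subset_closure ⟨n, r, f m, ?_⟩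
  simp

/-- The additive map `N ⊗_R f : N ⊗_R M → N ⊗_R M'`. -/
def BalancedTensor.map (N : Type u) [AddCommGroup N] [Module Rᵐᵒᵖ N]
    {M M' : Type u} [AddCommGroup M] [Module R M] [AddCommGroup M'] [Module R M']
    (f : M →ₗ[R] M') : BalancedTensor (R := R) N M →+ BalancedTensor (R := R) N M' :=
  QuotientAddGroup.map _ _ (preMap N f) (balancing_le_comap N f)

theorem BalancedTensor.hom_ext {N : Type u} [AddCommGroup N] [Module Rᵐᵒᵖ N]
    {M : Type u} [AddCommGroup M] [Module R M] {A : Type u} [AddCommGroup A]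
    {g h : BalancedTensor (R := R) N M →+ A}
    (w : ∀ (n : N) (m : M), g (QuotientAddGroup.mk (n ⊗ₜ[ℤ] m)) =
      h (QuotientAddGroup.mk (n ⊗ₜ[ℤ] m))) : g = h := by
  refine QuotientAddGroup.addMonoidHom_ext _ (AddMonoidHom.ext fun x => ?_)
  induction x using TensorProduct.induction_on with
  | zero => simp
  | tmul n m => exact w n m
  | add x y hx hy => rw [map_add, map_add, hx, hy]

@[simp]
theorem BalancedTensor.map_mk_tmul (N : Type u) [AddCommGroup N] [Module Rᵐᵒᵖ N]
    {M M' : Type u} [AddCommGroup M] [Module R M] [AddCommGroup M'] [Module R M']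
    (f : M →ₗ[R] M') (n : N) (m : M) :
    BalancedTensor.map N f (QuotientAddGroup.mk (n ⊗ₜ[ℤ] m)) =
      QuotientAddGroup.mk (n ⊗ₜ[ℤ] f m) := rfl

/-- The functor `N ⊗_R -` from left `R`-modules to abelian groups. -/
def tensorFunctor (N : ModuleCat.{u} Rᵐᵒᵖ) : ModuleCat.{u} R ⥤ AddCommGrpCat.{u} where
  obj M := AddCommGrpCat.of (BalancedTensor (R := R) N M)
  map f := AddCommGrpCat.ofHom (BalancedTensor.map N f.hom)
  map_id M := by
    apply AddCommGrpCat.hom_ext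
    apply BalancedTensor.hom_ext
    intro n m
    rfl
  map_comp f g := by
    apply AddCommGrpCat.hom_ext
    apply BalancedTensor.hom_ext
    intro n m
    rfl

instance (N : ModuleCat.{u} Rᵐᵒᵖ) : (tensorFunctor N).Additive where
  map_add {M M' f g} := by
    apply AddCommGrpCat.hom_ext
    apply BalancedTensor.hom_ext
    intro n m
    change QuotientAddGroup.mk (n ⊗ₜ[ℤ] (f.hom m + g.hom m)) =
      QuotientAddGroup.mk (n ⊗ₜ[ℤ] f.hom m) + QuotientAddGroup.mk (n ⊗ₜ[ℤ] g.hom m)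
    rw [TensorProduct.tmul_add]
    rfl

/-- `Tor_n^R(N, M)`, for a right `R`-module `N` and a left `R`-module `M`. -/
def tor (n : ℕ) (N : ModuleCat.{u} Rᵐᵒᵖ) (M : ModuleCat.{u} R) : AddCommGrpCat.{u} :=
  ((tensorFunctor N).leftDerived n).obj M

end Tensor

/-! ## Weak injective and weak flat modules -/

/-- `N` is super finitely presented: it has a projective resolution by finitely generated
projective modules. -/
def IsSuperFinitelyPresented {S : Type u} [Ring S] (N : ModuleCat.{u} S) : Prop :=
  ∃ P : ProjectiveResolution N, ∀ i, Module.Finite S (P.complex.X i)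

section

variable {R : Type u} [Ring R]

/-- `W` is weak injective: `Ext¹_R(N, W) = 0` for all super finitely presented left modules
`N`. -/
def IsWeakInjective (W : ModuleCat.{u} R) : Prop :=
  ∀ N : ModuleCat.{u} R, IsSuperFinitelyPresented N → Subsingleton (Abelian.Ext N W 1)

/-- The left module `W` is weak flat: `Tor₁^R(N, W) = 0` for all super finitely presented right
modules `N`. -/
def IsWeakFlat (W : ModuleCat.{u} R) : Prop :=
  ∀ N : ModuleCat.{u} Rᵐᵒᵖ, IsSuperFinitelyPresented N → IsZero (tor 1 N W)

/-! ## Hom complexes -/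

/-- The cochain complex `Hom_R(M, T)` of abelian groups, with `Hom_R(M, Tⁱ)` in degree `i`. -/
def homFrom (M : ModuleCat.{u} R) (T : CochainComplex (ModuleCat.{u} R) ℤ) :
    CochainComplex AddCommGrpCat.{u} ℤ :=
  ((preadditiveCoyoneda.obj (Opposite.op M)).mapHomologicalComplex (ComplexShape.up ℤ)).obj T

/-- The cochain complex `Hom_R(T, N)` of abelian groups, with `Hom_R(T_i, N)` in degree `i`. -/
def homInto (T : ChainComplex (ModuleCat.{u} R) ℤ) (N : ModuleCat.{u} R) :
    CochainComplex AddCommGrpCat.{u} ℤ :=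
  ((preadditiveYoneda.obj N).mapHomologicalComplex (ComplexShape.down ℤ).symm).obj T.op

/-! ## Gorenstein weak injective modules and dimension -/

/-- `T` is a `WI`-pure exact complex of injective modules. The two halves
`⋯ → I_1 → I_0 → I^0 → I^1 → ⋯` are indexed by `I^n = Tⁿ` and `I_n = T^{-1-n}` for `n ≥ 0`. -/
structure IsWIPureExact (T : CochainComplex (ModuleCat.{u} R) ℤ) : Prop where
  injective : ∀ i, Injective (T.X i)
  exact : ∀ i, T.ExactAt i
  pure : ∀ W : ModuleCat.{u} R, IsWeakInjective W → ∀ i, (homFrom W T).ExactAt i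

/-- `M` is Gorenstein weak injective: it is `Coker(I_1 → I_0)` for a `WI`-pure exact complex of
injective modules. -/
def IsGorensteinWeakInjective (M : ModuleCat.{u} R) : Prop :=
  ∃ T : CochainComplex (ModuleCat.{u} R) ℤ, IsWIPureExact T ∧
    Nonempty (M ≅ cokernel (T.d (-2) (-1)))

/-- There is an exact sequence `0 → M → G⁰ → ⋯ → Gⁿ → 0` with every `Gⁱ` Gorenstein weak
injective. -/
def HasGWICoresolution (M : ModuleCat.{u} R) (n : ℕ) : Prop :=
  ∃ (G : CochainComplex (ModuleCat.{u} R) ℕ) (ε : M ⟶ G.X 0),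
    Function.Injective ε ∧ Function.Exact ε (G.d 0 1) ∧
    (∀ i, Function.Exact (G.d i (i + 1)) (G.d (i + 1) (i + 2))) ∧
    (∀ i ≤ n, IsGorensteinWeakInjective (G.X i)) ∧ ∀ i, n < i → IsZero (G.X i)

/-- The Gorenstein weak injective dimension (`⊤` if there is no finite coresolution). -/
def gwid (M : ModuleCat.{u} R) : ℕ∞ :=
  ⨅ (n : ℕ) (_ : HasGWICoresolution M n), (n : ℕ∞)

/-! ## Gorenstein weak projective modules and dimension -/

/-- `T` is a `WF`-copure exact complex of projective modules. The two halves
`⋯ → P_1 → P_0 → P^0 → P^1 → ⋯` are indexed by `P_n = T_n` and `P^n = T_{-1-n}` for `n ≥ 0`. -/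
structure IsWFCopureExact (T : ChainComplex (ModuleCat.{u} R) ℤ) : Prop where
  projective : ∀ i, Projective (T.X i)
  exact : ∀ i, T.ExactAt i
  copure : ∀ W : ModuleCat.{u} R, IsWeakFlat W → ∀ i, (homInto T W).ExactAt i

/-- `M` is Gorenstein weak projective: it is `Coker(P_1 → P_0)` for a `WF`-copure exact complex
of projective modules. -/
def IsGorensteinWeakProjective (M : ModuleCat.{u} R) : Prop :=
  ∃ T : ChainComplex (ModuleCat.{u} R) ℤ, IsWFCopureExact T ∧
    Nonempty (M ≅ cokernel (T.d 1 0))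

/-- There is an exact sequence `0 → G_n → ⋯ → G_0 → M → 0` with every `G_i` Gorenstein weak
projective. -/
def HasGWPResolution (M : ModuleCat.{u} R) (n : ℕ) : Prop :=
  ∃ (G : ChainComplex (ModuleCat.{u} R) ℕ) (ε : G.X 0 ⟶ M),
    Function.Surjective ε ∧ Function.Exact (G.d 1 0) ε ∧
    (∀ i, Function.Exact (G.d (i + 2) (i + 1)) (G.d (i + 1) i)) ∧
    (∀ i ≤ n, IsGorensteinWeakProjective (G.X i)) ∧ ∀ i, n < i → IsZero (G.X i)

/-- The Gorenstein weak projective dimension (`⊤` if there is no finite resolution). -/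
def gwpd (M : ModuleCat.{u} R) : ℕ∞ :=
  ⨅ (n : ℕ) (_ : HasGWPResolution M n), (n : ℕ∞)

/-! ## Tate resolutions and relative Tate cohomology -/

/-- A `WI`-pure Tate injective resolution `N → E → T` of `N`. As `E` vanishes in negative
degrees, a morphism of complexes `u : E → T` is a family of maps in the degrees `n ≥ 0` that
commutes with the differentials. -/
structure WIPureTateResolution (N : ModuleCat.{u} R) where
  /-- the injective resolution of `N` -/
  E : InjectiveResolution N
  /-- the `WI`-pure exact complex of injective modules -/
  T : CochainComplex (ModuleCat.{u} R) ℤ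
  pureExact : IsWIPureExact T
  /-- the components of the morphism of complexes `E → T` -/
  u : ∀ n : ℕ, E.cocomplex.X n ⟶ T.X (n : ℤ)
  comm : ∀ n : ℕ, u n ≫ T.d (n : ℤ) ((n + 1 : ℕ) : ℤ) = E.cocomplex.d n (n + 1) ≫ u (n + 1)
  eventually_isIso : ∃ m : ℕ, ∀ n ≥ m, IsIso (u n)

/-- A `WF`-copure Tate projective resolution `T → P → M` of `M`. As `P` vanishes in negative
degrees, a morphism of complexes `u : T → P` is a family of maps in the degrees `n ≥ 0` that
commutes with the differentials. -/
structure WFCopureTateResolution (M : ModuleCat.{u} R) where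
  /-- the projective resolution of `M` -/
  P : ProjectiveResolution M
  /-- the `WF`-copure exact complex of projective modules -/
  T : ChainComplex (ModuleCat.{u} R) ℤ
  copureExact : IsWFCopureExact T
  /-- the components of the morphism of complexes `T → P` -/
  u : ∀ n : ℕ, T.X (n : ℤ) ⟶ P.complex.X n
  comm : ∀ n : ℕ, u (n + 1) ≫ P.complex.d (n + 1) n = T.d ((n + 1 : ℕ) : ℤ) (n : ℤ) ≫ u n
  eventually_isIso : ∃ m : ℕ, ∀ n ≥ m, IsIso (u n)

/-- The relative Tate cohomology `Ext^ⁱ_GWI(M, N) = Hⁱ(Hom_R(M, T))`, computed from a `WI`-pure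
Tate injective resolution `N → E → T`. -/
def tateExtGWI (M : ModuleCat.{u} R) {N : ModuleCat.{u} R} (ρ : WIPureTateResolution N)
    (i : ℤ) : AddCommGrpCat.{u} :=
  (homFrom M ρ.T).homology i

/-- The relative Tate cohomology `Ext^ⁱ_GWP(M, N) = Hⁱ(Hom_R(T, N))`, computed from a
`WF`-copure Tate projective resolution `T → P → M`. -/
def tateExtGWP {M : ModuleCat.{u} R} (τ : WFCopureTateResolution M) (N : ModuleCat.{u} R)
    (i : ℤ) : AddCommGrpCat.{u} :=
  (homInto τ.T N).homology i

end

end GorensteinWeak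

end

/-! Existence of Tate resolutions. A cokernel $G$ in a copure complex satisfies
$\operatorname{Ext}^1(G,W)=0$ for all test objects $W$, and projectives are test objects. Horseshoe
arguments on both sides then show that such cokernels are closed under extensions
(`IsCopureSyzygy.of_shortExact`). Hence a finite resolution of $M$ by them can be traded for
finitely many projective steps ending in one of them (`exists_hasCopureSyzygy_cokernel`). The copure
complex through that last syzygy agrees in high degrees with a projective resolution of $M$.
Copurity extends this identification down to degree 0, because the terms of the resolution are test
objects (`exists_extension_to_low_degrees`). All this takes place in an abelian category with an
arbitrary test class, so the injective half is the same result in the opposite category.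

Balance. Write $\mathbf T$ for the complex of projectives and $\mathbf T'$ for the complex of
injectives. Dimension shifting replaces $N$ in $\operatorname{Hom}(\mathbf T,N)$ by a high cosyzygy,
which is a kernel $Z$ in $\mathbf T'$, and $M$ in $\operatorname{Hom}(M,\mathbf T')$ by a high
syzygy, which is a cokernel $K$ in $\mathbf T$. For such $K$ and $Z$ both cohomology groups are
quotients of $\operatorname{Hom}(K,Z)$ by the same subgroup: a map extends to the next projective
term of $\mathbf T$ exactly when it lifts to the preceding injective term of $\mathbf T'$
(`tate_balance_syzygies`). This half uses exactness, projectivity and injectivity, but neither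
purity nor copurity. -/

namespace GorensteinWeak

noncomputable section

open Abelian
open scoped ZeroObject

universe w v u₁

/-! ### Copure exact complexes and their syzygies in an abelian category -/

section Abstract

variable {C : Type u₁} [Category.{v} C] [Abelian C]

/-- An exact complex of projective objects that stays exact under `Hom(-, w)` for all `w` in `W`. -/
structure CopureExact (W : C → Prop) (T : ChainComplex C ℤ) : Prop where
  projective : ∀ i, Projective (T.X i)
  exact : ∀ a b c : ℤ, c + 1 = b → b + 1 = a → (T.sc' a b c).Exact
  copure : ∀ w, W w → ∀ a b c : ℤ, c + 1 = b → b + 1 = a → ∀ f : T.X b ⟶ w,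
    T.d a b ≫ f = 0 → ∃ g : T.X c ⟶ w, T.d b c ≫ g = f

/-- `G` is the cokernel of a differential of a complex satisfying `CopureExact W`. -/
def IsCopureSyzygy (W : C → Prop) (G : C) : Prop :=
  ∃ T : ChainComplex C ℤ, CopureExact W T ∧
    ∃ a b : ℤ, b + 1 = a ∧ Nonempty (cokernel (T.d a b) ≅ G)

theorem shortExact_cokernel_desc {S : ShortComplex C} (hS : S.Exact) :
    (ShortComplex.mk (cokernel.desc S.f S.g S.zero) (cokernel.π S.g)
      (by rw [← cancel_epi (cokernel.π S.f)]; simp)).ShortExact := by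
  have : Mono (cokernel.desc S.f S.g S.zero) := hS.mono_cokernelDesc
  refine { exact := ?_ }
  refine ShortComplex.exact_of_g_is_cokernel _ ?_
  refine CokernelCofork.IsColimit.ofπ _ _
    (fun f hf => cokernel.desc S.g f (by simpa using cokernel.π S.f ≫= hf)) (fun f hf => by simp)
    (fun f hf m hm => by rw [← cancel_epi (cokernel.π S.g)]; simpa using hm)

/-- The third object of a right exact sequence is the cokernel of its first map. -/
def cokernelIsoOfExact (S : ShortComplex C) (hS : S.Exact) [Epi S.g] : cokernel S.f ≅ S.X₃ :=
  (cokernelIsCokernel S.f).coconePointUniqueUpToIso hS.gIsCokernel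

/-- The first object of a left exact sequence is the kernel of its second map. -/
def kernelIsoOfExact (S : ShortComplex C) (hS : S.Exact) [Mono S.f] : S.X₁ ≅ kernel S.g :=
  IsLimit.conePointUniqueUpToIso hS.fIsKernel (limit.isLimit _)

theorem shortExact_of_iso_left {S : ShortComplex C} (hS : S.ShortExact) {A : C} (e : A ≅ S.X₁) :
    (ShortComplex.mk (e.hom ≫ S.f) S.g (by simp)).ShortExact :=
  ShortComplex.shortExact_of_iso
    (ShortComplex.isoMk e.symm (Iso.refl _) (Iso.refl _) (by simp) (by simp)) hS

theorem shortExact_of_iso_right {S : ShortComplex C} (hS : S.ShortExact) {A : C} (e : S.X₃ ≅ A) :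
    (ShortComplex.mk S.f (S.g ≫ e.hom) (by simp)).ShortExact :=
  ShortComplex.shortExact_of_iso
    (S₁ := S) (ShortComplex.isoMk (Iso.refl _) (Iso.refl _) e (by simp) (by simp)) hS

/-- As $\operatorname{Ext}^1(B,X)=0$, every class in $\operatorname{Ext}^1(G,X)$ comes from a map
$A\to X$ under the connecting map, which kills the maps that extend to $B$. -/
theorem ext_eq_zero_of_exists_extension [HasExt.{w} C] {A B G : C} {i : A ⟶ B} {p : B ⟶ G}
    {hip : i ≫ p = 0} (hS : (ShortComplex.mk i p hip).ShortExact) (hP : Projective B) {X : C}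
    (h : ∀ f : A ⟶ X, ∃ g : B ⟶ X, i ≫ g = f) (x : Ext G X 1) : x = 0 := by
  obtain ⟨y, rfl⟩ := Ext.contravariant_sequence_exact₃ hS X x
    (Ext.eq_zero_of_projective _) (add_zero 1)
  obtain ⟨f, rfl⟩ := Ext.addEquiv₀.symm.surjective y
  obtain ⟨g, rfl⟩ := h f
  simp only [Ext.addEquiv₀_symm_apply]
  rw [← Ext.mk₀_comp_mk₀]
  exact hS.extClass_comp_assoc _

theorem CopureExact.shortExact {W : C → Prop} {T : ChainComplex C ℤ} (hT : CopureExact W T)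
    {a b c : ℤ} (hc : c + 1 = b) (hb : b + 1 = a) :
    (ShortComplex.mk (cokernel.desc (T.d a b) (T.d b c) (T.d_comp_d a b c))
      (cokernel.π (T.d b c)) (by rw [← cancel_epi (cokernel.π (T.d a b))]; simp)).ShortExact :=
  shortExact_cokernel_desc (hT.exact a b c hc hb)

/-- Splicing: exactness in the middle depends only on the image of the first map and the kernel of
the second. -/
theorem exact_epi_comp_comp_mono {S : ShortComplex C} (hS : S.Exact) {A B : C} (q : A ⟶ S.X₁)
    [Epi q] (m : S.X₃ ⟶ B) [Mono m] :
    (ShortComplex.mk (q ≫ S.f) (S.g ≫ m) (by simp)).Exact := by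
  let S' : ShortComplex C := ShortComplex.mk (q ≫ S.f) S.g (by simp)
  let φ : S' ⟶ S := { τ₁ := q, τ₂ := 𝟙 _, τ₃ := 𝟙 _ }
  let ψ : S' ⟶ ShortComplex.mk (q ≫ S.f) (S.g ≫ m) (by simp) :=
    { τ₁ := 𝟙 _, τ₂ := 𝟙 _, τ₃ := m }
  have : Epi φ.τ₁ := ‹Epi q›
  have : IsIso φ.τ₂ := inferInstanceAs (IsIso (𝟙 _))
  have : Mono φ.τ₃ := inferInstanceAs (Mono (𝟙 _))
  have : Epi ψ.τ₁ := inferInstanceAs (Epi (𝟙 _))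
  have : IsIso ψ.τ₂ := inferInstanceAs (IsIso (𝟙 _))
  have : Mono ψ.τ₃ := ‹Mono m›
  rw [← ShortComplex.exact_iff_of_epi_of_isIso_of_mono ψ,
    ShortComplex.exact_iff_of_epi_of_isIso_of_mono φ]
  exact hS

namespace IsCopureSyzygy

variable {W : C → Prop}

theorem of_iso {G G' : C} (h : IsCopureSyzygy W G) (e : G ≅ G') : IsCopureSyzygy W G' := by
  obtain ⟨T, hT, a, b, hab, ⟨e'⟩⟩ := h
  exact ⟨T, hT, a, b, hab, ⟨e' ≪≫ e⟩⟩

theorem exists_left {G : C} (h : IsCopureSyzygy W G) :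
    ∃ (K P : C) (i : K ⟶ P) (p : P ⟶ G) (h : i ≫ p = 0),
      (ShortComplex.mk i p h).ShortExact ∧ Projective P ∧ IsCopureSyzygy W K := by
  obtain ⟨T, hT, a, b, hab, ⟨e⟩⟩ := h
  exact ⟨_, _, _, _, _, shortExact_of_iso_right
    (hT.shortExact hab rfl) e, hT.projective b,
    ⟨T, hT, a + 1, a, rfl, ⟨Iso.refl _⟩⟩⟩

theorem exists_right {G : C} (h : IsCopureSyzygy W G) :
    ∃ (K P : C) (i : G ⟶ P) (p : P ⟶ K) (h : i ≫ p = 0),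
      (ShortComplex.mk i p h).ShortExact ∧ Projective P ∧ IsCopureSyzygy W K := by
  obtain ⟨T, hT, a, b, hab, ⟨e⟩⟩ := h
  exact ⟨_, _, _, _, _, shortExact_of_iso_left
    (hT.shortExact (sub_add_cancel b 1) hab) e.symm, hT.projective _,
    ⟨T, hT, b, b - 1, sub_add_cancel b 1, ⟨Iso.refl _⟩⟩⟩

theorem ext_eq_zero [HasExt.{w} C] {G : C} (h : IsCopureSyzygy W G) {X : C} (hX : W X)
    (x : Ext G X 1) : x = 0 := by
  obtain ⟨T, hT, a, b, hab, ⟨e⟩⟩ := h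
  refine ext_eq_zero_of_exists_extension (shortExact_of_iso_right
    (hT.shortExact hab rfl) e) (hT.projective b) (fun f => ?_) x
  obtain ⟨g, hg⟩ := hT.copure X hX (a + 1) a b hab rfl (cokernel.π (T.d (a + 1) a) ≫ f) (by simp)
  refine ⟨g, ?_⟩
  rw [← cancel_epi (cokernel.π _)]
  simpa using hg

end IsCopureSyzygy

theorem exists_extension_of_ext_eq_zero [HasExt.{w} C] {S : ShortComplex C} (hS : S.ShortExact)
    {X : C} (h : ∀ x : Ext S.X₃ X 1, x = 0) (f : S.X₁ ⟶ X) : ∃ g : S.X₂ ⟶ X, S.f ≫ g = f := by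
  obtain ⟨y, hy⟩ := Ext.contravariant_sequence_exact₁ hS X (Ext.mk₀ f) (add_zero 1) (h _)
  obtain ⟨g, rfl⟩ := Ext.addEquiv₀.symm.surjective y
  refine ⟨g, Ext.addEquiv₀.symm.injective ?_⟩
  simpa using hy

/-- A coinductive criterion: one syzygy step and one cosyzygy step inside a class orthogonal to `W`
suffice, since iterating both and splicing gives a complex that is infinite in both directions.
Closure properties then need only one-step constructions. -/
theorem isCopureSyzygy_of_class [HasExt.{w} C] {W : C → Prop} (X : C → Prop)
    (hExt : ∀ G, X G → ∀ Y, W Y → ∀ x : Ext G Y 1, x = 0)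
    (hl : ∀ G, X G → ∃ (K P : C) (i : K ⟶ P) (p : P ⟶ G) (h : i ≫ p = 0),
      (ShortComplex.mk i p h).ShortExact ∧ Projective P ∧ X K)
    (hr : ∀ G, X G → ∃ (K P : C) (i : G ⟶ P) (p : P ⟶ K) (h : i ≫ p = 0),
      (ShortComplex.mk i p h).ShortExact ∧ Projective P ∧ X K)
    {G : C} (hG : X G) : IsCopureSyzygy W G := by
  have hl' : ∀ G : Subtype X, ∃ K : Subtype X, ∃ (P : C) (i : K.1 ⟶ P) (p : P ⟶ G.1)
      (h : i ≫ p = 0), (ShortComplex.mk i p h).ShortExact ∧ Projective P := by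
    rintro ⟨G, hG⟩
    obtain ⟨K, P, i, p, h, hS, hP, hK⟩ := hl G hG
    exact ⟨⟨K, hK⟩, P, i, p, h, hS, hP⟩
  have hr' : ∀ G : Subtype X, ∃ K : Subtype X, ∃ (P : C) (i : G.1 ⟶ P) (p : P ⟶ K.1)
      (h : i ≫ p = 0), (ShortComplex.mk i p h).ShortExact ∧ Projective P := by
    rintro ⟨G, hG⟩
    obtain ⟨K, P, i, p, h, hS, hP, hK⟩ := hr G hG
    exact ⟨⟨K, hK⟩, P, i, p, h, hS, hP⟩
  choose l hl' using hl'
  choose r hr' using hr'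
  -- `Z n` is the iterated syzygy of `G` for `n ≥ 0` and the iterated cosyzygy for `n < 0`, so that
  -- `0 → Z (n + 1) → P n → Z n → 0` is exact for every `n`.
  let Z : ℤ → Subtype X := fun n => match n with
    | Int.ofNat n => l^[n] ⟨G, hG⟩
    | Int.negSucc n => r^[n + 1] ⟨G, hG⟩
  have hZ : ∀ n : ℤ, ∃ (P : C) (i : (Z (n + 1)).1 ⟶ P) (p : P ⟶ (Z n).1)
      (h : i ≫ p = 0), (ShortComplex.mk i p h).ShortExact ∧ Projective P := by
    rintro (n | n)
    · have := hl' (Z (Int.ofNat n))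
      have e : l (Z (Int.ofNat n)) = Z (Int.ofNat n + 1) :=
        (Function.iterate_succ_apply' l n _).symm
      rwa [e] at this
    · have := hr' (Z (Int.negSucc n + 1))
      have e : r (Z (Int.negSucc n + 1)) = Z (Int.negSucc n) := by
        cases n with
        | zero => rfl
        | succ n => exact (Function.iterate_succ_apply' r (n + 1) _).symm
      rwa [e] at this
  choose P i p hip hS hP using hZ
  have hi : ∀ n, Mono (i n) := fun n => (hS n).mono_f
  have hp : ∀ n, Epi (p n) := fun n => (hS n).epi_g
  let T : ChainComplex C ℤ := ChainComplex.of P (fun n => p (n + 1) ≫ i n)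
    (fun n => by simp [reassoc_of% hip (n + 1)])
  have hd : ∀ n, T.d (n + 1) n = p (n + 1) ≫ i n := fun n =>
    ChainComplex.of_d P (fun n => p (n + 1) ≫ i n) n
  refine ⟨T, ⟨hP, ?_, ?_⟩, 1, 0, rfl, ⟨?_⟩⟩
  · rintro _ _ c rfl rfl
    have := exact_epi_comp_comp_mono (hS (c + 1)).exact (p (c + 1 + 1)) (i c)
    dsimp at this
    simp only [← hd] at this
    exact this
  · rintro Y hY _ _ c rfl rfl f hf
    rw [hd] at hf
    rw [hd]
    -- A cocycle `f` descends to `Z (c + 1)`; the descended map extends along `Z (c + 1) → P c`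
    -- because `Ext¹(Z c, Y) = 0`.
    have hf' : i (c + 1) ≫ f = 0 := by
      rw [← cancel_epi (p (c + 1 + 1)), comp_zero, ← hf, Category.assoc]
    let k := (hS (c + 1)).exact.desc f hf'
    obtain ⟨g, hg⟩ := exists_extension_of_ext_eq_zero (hS c) (hExt _ (Z c).2 Y hY) k
    refine ⟨g, ?_⟩
    rw [Category.assoc]
    erw [hg]
    exact (hS (c + 1)).exact.g_desc f hf'
  · let S : ShortComplex C := ShortComplex.mk (p 1 ≫ i 0) (p 0) (by simp [hip])
    have : Epi S.g := hp 0
    have hS' : S.Exact := by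
      have := exact_epi_comp_comp_mono (hS 0).exact (p 1) (𝟙 _)
      dsimp at this
      simpa only [Category.comp_id] using this
    exact cokernelIsoOfEq (hd 0) ≪≫ cokernelIsoOfExact S hS'

/-! ### Snake lemma, horseshoes and closure under extensions -/

/-- The snake diagram of a morphism of short exact sequences. -/
def snakeInputOfShortExact {S S' : ShortComplex C} (hS : S.ShortExact) (hS' : S'.ShortExact)
    (φ : S ⟶ S') : ShortComplex.SnakeInput C where
  L₀ := kernel φ
  L₁ := S
  L₂ := S'
  L₃ := cokernel φ
  v₀₁ := kernel.ι φ
  v₁₂ := φ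
  v₂₃ := cokernel.π φ
  w₀₂ := kernel.condition φ
  w₁₃ := cokernel.condition φ
  h₀ := kernelIsKernel φ
  h₃ := cokernelIsCokernel φ
  L₁_exact := hS.exact
  epi_L₁_g := hS.epi_g
  L₂_exact := hS'.exact
  mono_L₂_f := hS'.mono_f

/-- The connecting map of the snake lemma lands in the cokernel of `φ.τ₁`, which vanishes. -/
theorem shortExact_kernel {S S' : ShortComplex C} (hS : S.ShortExact) (hS' : S'.ShortExact)
    (φ : S ⟶ S') [Epi φ.τ₁] : (kernel φ).ShortExact := by
  let D := snakeInputOfShortExact hS hS' φ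
  have hz : D.v₂₃.τ₁ = 0 := by
    have : Epi D.v₁₂.τ₁ := ‹Epi φ.τ₁›
    rw [← cancel_epi D.v₁₂.τ₁]
    simp
  have hz' : IsZero D.L₃.X₁ := by
    rw [IsZero.iff_id_eq_zero, ← cancel_epi D.v₂₃.τ₁, hz]
    simp
  have : Mono D.L₁.f := hS.mono_f
  exact { exact := D.L₀_exact
          mono_f := inferInstanceAs (Mono D.L₀.f)
          epi_g := D.L₁'_exact.epi_f (hz'.eq_of_tgt _ _) }

theorem shortExact_cokernel {S S' : ShortComplex C} (hS : S.ShortExact) (hS' : S'.ShortExact)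
    (φ : S ⟶ S') [Mono φ.τ₃] : (cokernel φ).ShortExact := by
  let D := snakeInputOfShortExact hS hS' φ
  have hz : D.v₀₁.τ₃ = 0 := by
    have : Mono D.v₁₂.τ₃ := ‹Mono φ.τ₃›
    rw [← cancel_mono D.v₁₂.τ₃]
    simp
  have hz' : IsZero D.L₀.X₃ := by
    rw [IsZero.iff_id_eq_zero, ← cancel_mono D.v₀₁.τ₃, hz]
    simp
  have : Epi D.L₂.g := hS'.epi_g
  exact { exact := D.L₃_exact
          mono_f := D.L₂'_exact.mono_g (hz'.eq_of_src _ _)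
          epi_g := inferInstanceAs (Epi D.L₃.g) }

theorem exists_horseshoe_left {A B G K P K' P' : C} {i : A ⟶ B} {p : B ⟶ G} {hip : i ≫ p = 0}
    (h : (ShortComplex.mk i p hip).ShortExact)
    {j : K ⟶ P} {q : P ⟶ A} {hjq : j ≫ q = 0} (h₁ : (ShortComplex.mk j q hjq).ShortExact)
    {j' : K' ⟶ P'} {q' : P' ⟶ G} {hjq' : j' ≫ q' = 0} (h₂ : (ShortComplex.mk j' q' hjq').ShortExact)
    (l : P' ⟶ B) (hl : l ≫ p = q') :
    ∃ (L : C) (s : L ⟶ P ⊞ P') (t : P ⊞ P' ⟶ B) (hst : s ≫ t = 0) (a : K ⟶ L) (b : L ⟶ K')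
      (hab : a ≫ b = 0), (ShortComplex.mk s t hst).ShortExact ∧
        (ShortComplex.mk a b hab).ShortExact := by
  have hS : (ShortComplex.mk (biprod.inl : P ⟶ P ⊞ P') biprod.snd (by simp)).ShortExact :=
    (ShortComplex.Splitting.ofHasBinaryBiproduct P P').shortExact
  let φ : ShortComplex.mk (biprod.inl : P ⟶ P ⊞ P') biprod.snd (by simp) ⟶
      ShortComplex.mk i p hip :=
    { τ₁ := q, τ₂ := biprod.desc (q ≫ i) l, τ₃ := q'
      comm₂₃ := by ext <;> simp [hl, hip] }
  have e₁ : Epi φ.τ₁ := h₁.epi_g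
  have e₃ : Epi φ.τ₃ := h₂.epi_g
  have := h.epi_g
  have e₂ : Epi φ.τ₂ := ShortComplex.epi_τ₂_of_exact_of_epi φ h.exact
  have := shortExact_kernel hS h φ
  let D := snakeInputOfShortExact hS h φ
  let eK : K ≅ (kernel φ).X₁ := IsLimit.conePointUniqueUpToIso h₁.fIsKernel D.h₀τ₁
  let eK' : (kernel φ).X₃ ≅ K' := IsLimit.conePointUniqueUpToIso D.h₀τ₃ h₂.fIsKernel
  exact ⟨_, _, _, _, _, _, _, { exact := D.exact_C₂_up, mono_f := D.mono_v₀₁_τ₂, epi_g := e₂ },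
    shortExact_of_iso_left (shortExact_of_iso_right this eK') eK⟩

/-- The object `P` need not be injective, so the extension `l` of `j` to `B` is an input; in the
application it comes from the vanishing of $\operatorname{Ext}^1(G,P)$. -/
theorem exists_horseshoe_right {A B G K P K' P' : C} {i : A ⟶ B} {p : B ⟶ G} {hip : i ≫ p = 0}
    (h : (ShortComplex.mk i p hip).ShortExact)
    {j : A ⟶ P} {q : P ⟶ K} {hjq : j ≫ q = 0} (h₁ : (ShortComplex.mk j q hjq).ShortExact)
    {j' : G ⟶ P'} {q' : P' ⟶ K'} {hjq' : j' ≫ q' = 0} (h₂ : (ShortComplex.mk j' q' hjq').ShortExact)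
    (l : B ⟶ P) (hl : i ≫ l = j) :
    ∃ (L : C) (s : B ⟶ P ⊞ P') (t : P ⊞ P' ⟶ L) (hst : s ≫ t = 0) (a : K ⟶ L) (b : L ⟶ K')
      (hab : a ≫ b = 0), (ShortComplex.mk s t hst).ShortExact ∧
        (ShortComplex.mk a b hab).ShortExact := by
  have hS : (ShortComplex.mk (biprod.inl : P ⟶ P ⊞ P') biprod.snd (by simp)).ShortExact :=
    (ShortComplex.Splitting.ofHasBinaryBiproduct P P').shortExact
  let φ : ShortComplex.mk i p hip ⟶
      ShortComplex.mk (biprod.inl : P ⟶ P ⊞ P') biprod.snd (by simp) :=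
    { τ₁ := j, τ₂ := biprod.lift l (p ≫ j'), τ₃ := j'
      comm₁₂ := by ext <;> simp [hl, reassoc_of% hip] }
  have e₁ : Mono φ.τ₁ := h₁.mono_f
  have e₃ : Mono φ.τ₃ := h₂.mono_f
  have := h.mono_f
  have e₂ : Mono φ.τ₂ := ShortComplex.mono_τ₂_of_exact_of_mono φ h.exact
  have := shortExact_cokernel h hS φ
  let D := snakeInputOfShortExact h hS φ
  let eK : K ≅ (cokernel φ).X₁ := IsColimit.coconePointUniqueUpToIso h₁.gIsCokernel D.h₃τ₁
  let eK' : (cokernel φ).X₃ ≅ K' := IsColimit.coconePointUniqueUpToIso D.h₃τ₃ h₂.gIsCokernel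
  exact ⟨_, _, _, _, _, _, _, { exact := D.exact_C₂_down, mono_f := e₂, epi_g := D.epi_v₂₃_τ₂ },
    shortExact_of_iso_left (shortExact_of_iso_right this eK') eK⟩

theorem exists_kernel_comp {A B G K P : C} {i : A ⟶ B} {p : B ⟶ G} {hip : i ≫ p = 0}
    (h : (ShortComplex.mk i p hip).ShortExact)
    {j : K ⟶ P} {q : P ⟶ B} {hjq : j ≫ q = 0} (h₁ : (ShortComplex.mk j q hjq).ShortExact) :
    ∃ (L : C) (s : L ⟶ P) (hs : s ≫ q ≫ p = 0) (a : K ⟶ L) (b : L ⟶ A) (hab : a ≫ b = 0),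
      (ShortComplex.mk s (q ≫ p) hs).ShortExact ∧ (ShortComplex.mk a b hab).ShortExact := by
  have : Epi p := h.epi_g
  have : Epi q := h₁.epi_g
  have hS : (ShortComplex.mk (0 : (0 : C) ⟶ G) (𝟙 G) (by simp)).ShortExact :=
    { exact := (ShortComplex.exact_iff_mono _ rfl).2 (inferInstanceAs (Mono (𝟙 G)))
      mono_f := inferInstanceAs (Mono (0 : (0 : C) ⟶ G))
      epi_g := inferInstanceAs (Epi (𝟙 G)) }
  -- Mapping to `0 → G = G` makes the kernels of the three vertical maps `K`, `ker (q ≫ p)` and `A`.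
  let φ : ShortComplex.mk j q hjq ⟶ ShortComplex.mk (0 : (0 : C) ⟶ G) (𝟙 G) (by simp) :=
    { τ₁ := 0, τ₂ := q ≫ p, τ₃ := p, comm₁₂ := by simp [reassoc_of% hjq] }
  have e₁ : Epi φ.τ₁ := ⟨fun _ _ _ => (isZero_zero C).eq_of_src _ _⟩
  have := shortExact_kernel h₁ hS φ
  let D := snakeInputOfShortExact h₁ hS φ
  let eK : K ≅ (kernel φ).X₁ :=
    IsLimit.conePointUniqueUpToIso (KernelFork.IsLimit.ofId (0 : K ⟶ (0 : C)) rfl) D.h₀τ₁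
  let eA : (kernel φ).X₃ ≅ A := IsLimit.conePointUniqueUpToIso D.h₀τ₃ h.fIsKernel
  exact ⟨_, _, _, _, _, _, { exact := D.exact_C₂_up, mono_f := D.mono_v₀₁_τ₂
                             epi_g := inferInstanceAs (Epi (q ≫ p)) },
    shortExact_of_iso_left (shortExact_of_iso_right this eA) eK⟩

theorem IsCopureSyzygy.of_shortExact [HasExt.{w} C] {W : C → Prop}
    (hW : ∀ P : C, Projective P → W P) {A B G : C} {i : A ⟶ B} {p : B ⟶ G} {hip : i ≫ p = 0}
    (h : (ShortComplex.mk i p hip).ShortExact) (hA : IsCopureSyzygy W A)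
    (hG : IsCopureSyzygy W G) : IsCopureSyzygy W B := by
  -- The class of all extensions of one copure syzygy by another: both horseshoes return an object
  -- of the same class.
  refine isCopureSyzygy_of_class (fun B => ∃ (A G : C) (i : A ⟶ B) (p : B ⟶ G) (hip : i ≫ p = 0),
      (ShortComplex.mk i p hip).ShortExact ∧ IsCopureSyzygy W A ∧ IsCopureSyzygy W G)
    ?_ ?_ ?_ ⟨A, G, i, p, hip, h, hA, hG⟩
  · rintro B ⟨A, G, i, p, hip, h, hA, hG⟩ Y hY x
    obtain ⟨y, rfl⟩ := Ext.contravariant_sequence_exact₂ h Y x (hA.ext_eq_zero hY _)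
    rw [hG.ext_eq_zero hY y, Ext.comp_zero]
  · rintro B ⟨A, G, i, p, hip, h, hA, hG⟩
    obtain ⟨K, P, j, q, hjq, h₁, hP, hK⟩ := hA.exists_left
    obtain ⟨K', P', j', q', hjq', h₂, hP', hK'⟩ := hG.exists_left
    have : Epi p := h.epi_g
    obtain ⟨L, s, t, hst, a, b, hab, h₃, h₄⟩ := exists_horseshoe_left h h₁ h₂
      (Projective.factorThru q' p) (Projective.factorThru_comp _ _)
    exact ⟨L, _, s, t, hst, h₃, inferInstance, K, K', a, b, hab, h₄, hK, hK'⟩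
  · rintro B ⟨A, G, i, p, hip, h, hA, hG⟩
    obtain ⟨K, P, j, q, hjq, h₁, hP, hK⟩ := hA.exists_right
    obtain ⟨K', P', j', q', hjq', h₂, hP', hK'⟩ := hG.exists_right
    obtain ⟨l, hl⟩ := exists_extension_of_ext_eq_zero h
      (fun x => hG.ext_eq_zero (hW P hP) x) j
    obtain ⟨L, s, t, hst, a, b, hab, h₃, h₄⟩ := exists_horseshoe_right h h₁ h₂ l hl
    exact ⟨L, _, s, t, hst, h₃, inferInstance, K, K', a, b, hab, h₄, hK, hK'⟩

/-! ### Objects with a copure syzygy after finitely many projective steps -/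

/-- `M` has an `n`-th syzygy that is a syzygy of a complex satisfying `CopureExact W`. -/
def HasCopureSyzygy (W : C → Prop) : ℕ → C → Prop
  | 0, M => IsCopureSyzygy W M
  | n + 1, M => ∃ (K P : C) (i : K ⟶ P) (p : P ⟶ M) (h : i ≫ p = 0),
      (ShortComplex.mk i p h).ShortExact ∧ Projective P ∧ HasCopureSyzygy W n K

namespace HasCopureSyzygy

variable {W : C → Prop}

theorem succ {n : ℕ} {M : C} (h : HasCopureSyzygy W n M) : HasCopureSyzygy W (n + 1) M := by
  induction n generalizing M with
  | zero => exact IsCopureSyzygy.exists_left h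
  | succ n ih =>
    obtain ⟨K, P, i, p, hip, hS, hP, hK⟩ := h
    exact ⟨K, P, i, p, hip, hS, hP, ih hK⟩

theorem mono {n m : ℕ} (hnm : n ≤ m) {M : C} (h : HasCopureSyzygy W n M) :
    HasCopureSyzygy W m M := by
  induction hnm with
  | refl => exact h
  | step _ ih => exact ih.succ

theorem of_iso {n : ℕ} {M M' : C} (h : HasCopureSyzygy W n M) (e : M ≅ M') :
    HasCopureSyzygy W n M' := by
  cases n with
  | zero => exact IsCopureSyzygy.of_iso h e
  | succ n =>
    obtain ⟨K, P, i, p, hip, hS, hP, hK⟩ := h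
    exact ⟨K, P, i, _, _, shortExact_of_iso_right hS e, hP, hK⟩

theorem of_shortExact [HasExt.{w} C] (hW : ∀ P : C, Projective P → W P) {n : ℕ} {A B G : C}
    {i : A ⟶ B} {p : B ⟶ G} {hip : i ≫ p = 0} (h : (ShortComplex.mk i p hip).ShortExact)
    (hA : HasCopureSyzygy W n A) (hG : HasCopureSyzygy W n G) : HasCopureSyzygy W n B := by
  induction n generalizing A B G with
  | zero => exact IsCopureSyzygy.of_shortExact hW h hA hG
  | succ n ih =>
    obtain ⟨K, P, j, q, hjq, h₁, hP, hK⟩ := hA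
    obtain ⟨K', P', j', q', hjq', h₂, hP', hK'⟩ := hG
    have : Epi p := h.epi_g
    obtain ⟨L, s, t, hst, a, b, hab, h₃, h₄⟩ := exists_horseshoe_left h h₁ h₂
      (Projective.factorThru q' p) (Projective.factorThru_comp _ _)
    exact ⟨L, _, s, t, hst, h₃, inferInstance, ih h₄ hK hK'⟩

/-- For a projective cover step `0 → K → P → B → 0`, the kernel `L` of `P → B → G` sits in `0 → K →
L → A → 0`, so closure under extensions applies to `L`. -/
theorem right_of_shortExact [HasExt.{w} C] (hW : ∀ P : C, Projective P → W P) {n : ℕ} {A B G : C}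
    {i : A ⟶ B} {p : B ⟶ G} {hip : i ≫ p = 0} (h : (ShortComplex.mk i p hip).ShortExact)
    (hA : HasCopureSyzygy W n A) (hB : IsCopureSyzygy W B) : HasCopureSyzygy W (n + 1) G := by
  obtain ⟨K, P, j, q, hjq, h₁, hP, hK⟩ := hB.exists_left
  obtain ⟨L, s, hs, a, b, hab, h₃, h₄⟩ := exists_kernel_comp h h₁
  exact ⟨L, P, s, q ≫ p, hs, h₃, hP, of_shortExact hW h₄ (mono (Nat.zero_le n) hK) hA⟩

end HasCopureSyzygy

theorem exists_hasCopureSyzygy_cokernel [HasExt.{w} C] {W : C → Prop}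
    (hW : ∀ P : C, Projective P → W P) (G : ChainComplex C ℕ)
    (hex : ∀ i, (G.sc' (i + 2) (i + 1) i).Exact) (n : ℕ)
    (hG : ∀ i ≤ n, IsCopureSyzygy W (G.X i)) (hz : ∀ i, n < i → IsZero (G.X i)) :
    HasCopureSyzygy W n (cokernel (G.d 1 0)) := by
  -- Descending induction on the degree `j`: at `j = n` the incoming differential is zero and the
  -- cokernel is `G.X n` itself.
  suffices H : ∀ k j, j + k = n → HasCopureSyzygy W k (cokernel (G.d (j + 1) j)) from
    H n 0 (zero_add n)
  intro k
  induction k with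
  | zero =>
    intro j hj
    exact IsCopureSyzygy.of_iso (hG j (by lia))
      ((cokernelIsoOfEq ((hz (j + 1) (by lia)).eq_of_src (G.d (j + 1) j) 0) ≪≫
        cokernelZeroIsoTarget).symm)
  | succ k ih =>
    intro j hj
    exact HasCopureSyzygy.right_of_shortExact hW (shortExact_cokernel_desc (hex j))
      (ih (j + 1) (by lia)) (hG j (by lia))

/-! ### From copure syzygies to Tate resolutions -/

/-- `P`, augmented by `ε`, is a projective resolution of `M`. -/
structure IsProjectiveResolution (P : ChainComplex C ℕ) {M : C} (ε : P.X 0 ⟶ M) : Prop where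
  projective : ∀ i, Projective (P.X i)
  exact : ∀ i, (P.sc' (i + 2) (i + 1) i).Exact
  zero : P.d 1 0 ≫ ε = 0
  exact_zero : (ShortComplex.mk (P.d 1 0) ε zero).Exact
  epi : Epi ε

/-- `M` has a projective resolution that agrees in high degrees with a shift of a complex
satisfying `CopureExact W`. -/
def HasShiftedCopureExact (W : C → Prop) (M : C) : Prop :=
  ∃ (P : ChainComplex C ℕ) (ε : P.X 0 ⟶ M) (T : ChainComplex C ℤ) (m : ℕ) (k : ℤ)
    (e : ∀ (n : ℕ) (a : ℤ), m ≤ n → a = n + k → (T.X a ≅ P.X n)),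
    IsProjectiveResolution P ε ∧ CopureExact W T ∧
    ∀ (n : ℕ) (a b : ℤ) (hn : m ≤ n) (ha : a = n + k) (hb : b = (n + 1 : ℕ) + k),
      T.d b a ≫ (e n a hn ha).hom = (e (n + 1) b (by lia) hb).hom ≫ P.d (n + 1) n

/-- The part of `T` in degrees at least `k`, as a complex indexed by `ℕ`. -/
def truncateBelow (T : ChainComplex C ℤ) (k : ℤ) : ChainComplex C ℕ where
  X n := T.X (n + k)
  d i j := T.d (i + k) (j + k)
  shape i j h := T.shape _ _ (by simp at h ⊢; lia)
  d_comp_d' i j l _ _ := T.d_comp_d _ _ _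

/-- The complex `T` shifted by `k`, without signs. -/
def translate (T : ChainComplex C ℤ) (k : ℤ) : ChainComplex C ℤ where
  X n := T.X (n + k)
  d i j := T.d (i + k) (j + k)
  shape i j h := T.shape _ _ (by simp at h ⊢; lia)
  d_comp_d' i j l _ _ := T.d_comp_d _ _ _

theorem CopureExact.translate {W : C → Prop} {T : ChainComplex C ℤ} (hT : CopureExact W T) (k : ℤ) :
    CopureExact W (translate T k) where
  projective i := hT.projective _
  exact a b c hc hb := hT.exact _ _ _ (by lia) (by lia)
  copure w hw a b c hc hb f hf := hT.copure w hw (a + k) (b + k) (c + k) (by lia) (by lia) f hf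

theorem IsCopureSyzygy.hasShiftedCopureExact {W : C → Prop} {M : C} (h : IsCopureSyzygy W M) :
    HasShiftedCopureExact W M := by
  obtain ⟨T, hT, a, b, hab, ⟨e⟩⟩ := h
  obtain ⟨e⟩ : Nonempty (cokernel ((truncateBelow T b).d 1 0) ≅ M) := by
    have h₁ : ((1 : ℕ) : ℤ) + b = a := by lia
    have h₀ : ((0 : ℕ) : ℤ) + b = b := by lia
    change Nonempty (cokernel (T.d (((1 : ℕ) : ℤ) + b) (((0 : ℕ) : ℤ) + b)) ≅ M)
    rw [h₁, h₀]
    exact ⟨e⟩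
  let S : ShortComplex C := ShortComplex.mk ((truncateBelow T b).d 1 0)
    (cokernel.π _ ≫ e.hom) (cokernel.condition_assoc _ _ |>.trans zero_comp)
  refine ⟨truncateBelow T b, S.g, T, 0, b, fun n a _ ha => eqToIso (by rw [ha]; rfl),
    ⟨fun i => hT.projective _, fun i => hT.exact _ _ _ (by lia) (by lia), S.zero, ?_, ?_⟩, hT, ?_⟩
  · exact ShortComplex.exact_of_g_is_cokernel _
      (CokernelCofork.IsColimit.ofπ _ _ (fun f hf => e.inv ≫ cokernel.desc _ f hf)
        (fun f hf => by simp [S]) (fun f hf m hm => by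
          rw [← cancel_epi e.hom, ← cancel_epi (cokernel.π _)]
          simpa [S] using hm))
  · exact epi_comp _ _
  · rintro n _ _ _ rfl rfl
    exact (Category.comp_id _).trans (Category.id_comp _).symm

theorem HasShiftedCopureExact.of_shortExact {W : C → Prop} {K P M : C} {i : K ⟶ P} {p : P ⟶ M}
    {hip : i ≫ p = 0} (h : (ShortComplex.mk i p hip).ShortExact) (hP : Projective P)
    (hK : HasShiftedCopureExact W K) : HasShiftedCopureExact W M := by
  obtain ⟨Q, ε, T, m, k, e, hQ, hT, he⟩ := hK
  have := h.mono_f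
  have := h.epi_g
  have := hQ.epi
  have hz : Q.d 1 0 ≫ ε ≫ i = 0 := by rw [← Category.assoc, hQ.zero, zero_comp]
  -- Augmenting moves `Q` up by one degree while `T` stays put: the bound becomes `m + 1` and the
  -- shift `k - 1`.
  refine ⟨Q.augment (ε ≫ i) hz, p, T, m + 1, k - 1, fun n a hn ha => match n, hn, ha with
    | n + 1, hn, ha => e n a (by omega) (by push_cast at ha; omega), ⟨?_, ?_, ?_, ?_, h.epi_g⟩, hT, ?_⟩
  · rintro (_ | i)
    · exact hP
    · exact hQ.projective i
  · rintro (_ | j)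
    · have := exact_epi_comp_comp_mono hQ.exact_zero (𝟙 _) i
      simp only [Category.id_comp] at this
      exact this
    · exact hQ.exact j
  · change (ε ≫ i) ≫ p = 0
    rw [Category.assoc, hip, comp_zero]
  · have := exact_epi_comp_comp_mono h.exact ε (𝟙 _)
    simp only [Category.comp_id] at this
    exact this
  · rintro (_ | n) a b hn ha hb
    · omega
    · exact he n a b (by omega) _ _

theorem HasCopureSyzygy.hasShiftedCopureExact {W : C → Prop} {n : ℕ} {M : C}
    (h : HasCopureSyzygy W n M) : HasShiftedCopureExact W M := by
  induction n generalizing M with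
  | zero => exact IsCopureSyzygy.hasShiftedCopureExact h
  | succ n ih =>
    obtain ⟨K, P, i, p, hip, hS, hP, hK⟩ := h
    exact (ih hK).of_shortExact hS hP

/-- The composite `u (m + 1) ≫ P.d (m + 1) m` is a cocycle in `Hom(T, P.X m)`, so copurity factors
it through `T.X m`; the factor serves as the new component in degree `m`. The given components below
`m` carry no condition and are overwritten. -/
theorem exists_extension_to_low_degrees {W : C → Prop} {T : ChainComplex C ℤ}
    (hT : CopureExact W T) {P : ChainComplex C ℕ} (hP : ∀ i, W (P.X i)) (m : ℕ)
    (u : ∀ n : ℕ, T.X n ⟶ P.X n)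
    (hu : ∀ n ≥ m, u (n + 1) ≫ P.d (n + 1) n = T.d ((n + 1 : ℕ) : ℤ) (n : ℤ) ≫ u n) :
    ∃ u' : ∀ n : ℕ, T.X n ⟶ P.X n,
      (∀ n, u' (n + 1) ≫ P.d (n + 1) n = T.d ((n + 1 : ℕ) : ℤ) (n : ℤ) ≫ u' n) ∧
      ∀ n ≥ m, u' n = u n := by
  induction m generalizing u with
  | zero => exact ⟨u, fun n => hu n (Nat.zero_le n), fun _ _ => rfl⟩
  | succ m ih =>
    obtain ⟨g, hg⟩ := hT.copure _ (hP m) ((m + 1 + 1 : ℕ) : ℤ) ((m + 1 : ℕ) : ℤ) (m : ℤ)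
      (by lia) (by lia) (u (m + 1) ≫ P.d (m + 1) m) (by
        rw [← Category.assoc, ← hu (m + 1) le_rfl, Category.assoc, P.d_comp_d, comp_zero])
    obtain ⟨u', h₁, h₂⟩ := ih (Function.update u m g) (fun n hn => by
      rcases hn.eq_or_lt with rfl | hn
      · rw [Function.update_of_ne (by omega), Function.update_self]
        exact hg.symm
      · rw [Function.update_of_ne (by lia), Function.update_of_ne (by lia)]
        exact hu n hn)
    refine ⟨u', h₁, fun n hn => ?_⟩
    rw [h₂ n (by lia), Function.update_of_ne (by lia)]

theorem HasCopureSyzygy.exists_tate {W : C → Prop} (hW : ∀ P : C, Projective P → W P) {n : ℕ}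
    {M : C} (h : HasCopureSyzygy W n M) :
    ∃ (P : ChainComplex C ℕ) (ε : P.X 0 ⟶ M) (T : ChainComplex C ℤ)
      (u : ∀ n : ℕ, T.X n ⟶ P.X n), IsProjectiveResolution P ε ∧ CopureExact W T ∧
      (∀ n, u (n + 1) ≫ P.d (n + 1) n = T.d ((n + 1 : ℕ) : ℤ) (n : ℤ) ≫ u n) ∧
      ∃ m : ℕ, ∀ n ≥ m, IsIso (u n) := by
  obtain ⟨P, ε, T, m, k, e, hP, hT, he⟩ := h.hasShiftedCopureExact
  -- The zero maps below `m` are placeholders.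
  let u : ∀ n : ℕ, (translate T k).X n ⟶ P.X n := fun n =>
    if hn : m ≤ n then (e n (n + k) hn rfl).hom else 0
  have hu : ∀ n (hn : m ≤ n), u n = (e n (n + k) hn rfl).hom := fun n hn => dif_pos hn
  obtain ⟨u', h₁, h₂⟩ := exists_extension_to_low_degrees (hT.translate k)
    (fun i => hW _ (hP.projective i)) m u (fun n hn => by
      rw [hu n hn, hu (n + 1) (by omega)]
      exact (he n _ _ hn rfl rfl).symm)
  refine ⟨P, ε, translate T k, u', hP, hT.translate k, h₁, m, fun n hn => ?_⟩
  rw [h₂ n hn, hu n hn]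
  exact (e n _ hn rfl).isIso_hom

/-- The projective resolution given by `IsProjectiveResolution`. -/
def IsProjectiveResolution.resolution {P : ChainComplex C ℕ} {M : C} {ε : P.X 0 ⟶ M}
    (h : IsProjectiveResolution P ε) : ProjectiveResolution M where
  complex := P
  projective := h.projective
  π := (ChainComplex.toSingle₀Equiv _ _).symm ⟨ε, h.zero⟩
  quasiIso := ⟨fun n => by
    cases n with
    | zero =>
      rw [ChainComplex.quasiIsoAt₀_iff, ShortComplex.quasiIso_iff_of_zeros']
      · have := h.epi
        refine (ShortComplex.exact_and_epi_g_iff_of_iso ?_).2 ⟨h.exact_zero, h.epi⟩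
        exact ShortComplex.isoMk (Iso.refl _) (Iso.refl _) (Iso.refl _)
          ((Category.id_comp _).trans (Category.comp_id _).symm)
          ((Category.id_comp _).trans ((Category.comp_id _).trans
            (ChainComplex.toSingle₀Equiv_symm_apply_f_zero ε h.zero)).symm)
      · exact P.shape _ _ (by simp)
      all_goals rfl
    | succ n =>
      rw [quasiIsoAt_iff_exactAt']
      · exact (P.exactAt_iff' (n + 2) (n + 1) n (by simp) (by simp)).2 (h.exact n)
      · apply ChainComplex.exactAt_succ_single_obj⟩

/-! ### Passage to the opposite category -/

/-- The opposite of a cochain complex, as a chain complex. -/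
def opChain {α : Type*} [AddRightCancelSemigroup α] [One α] (T : CochainComplex C α) :
    ChainComplex Cᵒᵖ α where
  X i := Opposite.op (T.X i)
  d i j := (T.d j i).op
  shape i j h := by rw [T.shape j i h, op_zero]
  d_comp_d' i j k _ _ := by rw [← op_comp, T.d_comp_d, op_zero]

/-- A chain complex in the opposite category, as a cochain complex. -/
def unopCochain {α : Type*} [AddRightCancelSemigroup α] [One α] (T : ChainComplex Cᵒᵖ α) :
    CochainComplex C α where
  X i := (T.X i).unop
  d i j := (T.d j i).unop
  shape i j h := by rw [T.shape j i h, unop_zero]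
  d_comp_d' i j k _ _ := by rw [← unop_comp, T.d_comp_d, unop_zero]

theorem exact_cokernel_desc {S : ShortComplex C} (hS : S.Exact) {B : C} {f : B ⟶ S.X₁}
    (hf : f ≫ S.f = 0) : (ShortComplex.mk (cokernel.desc f S.f hf) S.g
      (by rw [← cancel_epi (cokernel.π f)]; simp)).Exact := by
  let φ : S ⟶ ShortComplex.mk (cokernel.desc f S.f hf) S.g
      (by rw [← cancel_epi (cokernel.π f)]; simp) :=
    { τ₁ := cokernel.π f, τ₂ := 𝟙 _, τ₃ := 𝟙 _ }
  have : Epi φ.τ₁ := inferInstanceAs (Epi (cokernel.π _))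
  have : IsIso φ.τ₂ := inferInstanceAs (IsIso (𝟙 _))
  have : Mono φ.τ₃ := inferInstanceAs (Mono (𝟙 _))
  rwa [← ShortComplex.exact_iff_of_epi_of_isIso_of_mono φ]

/-- The injective resolution given by a projective resolution in the opposite category. -/
def IsProjectiveResolution.unopResolution {P : ChainComplex Cᵒᵖ ℕ} {N : C}
    {ε : P.X 0 ⟶ Opposite.op N} (h : IsProjectiveResolution P ε) : InjectiveResolution N where
  cocomplex := unopCochain P
  injective n := by
    have := h.projective n
    exact inferInstanceAs (Injective (P.X n).unop)
  ι := (CochainComplex.fromSingle₀Equiv _ _).symm ⟨ε.unop, congrArg Quiver.Hom.unop h.zero⟩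
  quasiIso := ⟨fun n => by
    cases n with
    | zero =>
      rw [CochainComplex.quasiIsoAt₀_iff, ShortComplex.quasiIso_iff_of_zeros]
      · have := h.epi
        refine (ShortComplex.exact_and_mono_f_iff_of_iso ?_).2
          ⟨h.exact_zero.unop, inferInstanceAs (Mono ε.unop)⟩
        exact ShortComplex.isoMk (Iso.refl _) (Iso.refl _) (Iso.refl _)
          ((Category.id_comp _).trans ((Category.comp_id _).trans
            (CochainComplex.fromSingle₀Equiv_symm_apply_f_zero (C := unopCochain P) (X := N)
              ε.unop (congrArg Quiver.Hom.unop h.zero))).symm)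
          ((Category.id_comp _).trans (Category.comp_id _).symm)
      · rfl
      · rfl
      · exact (unopCochain P).shape _ _ (by simp)
    | succ n =>
      rw [quasiIsoAt_iff_exactAt]
      · exact (HomologicalComplex.exactAt_iff' _ n (n + 1) (n + 2) (by simp) (by simp)).2
          (h.exact n).unop
      · apply CochainComplex.exactAt_succ_single_obj⟩

end Abstract

/-! ### Gorenstein weak modules and the existence of Tate resolutions -/

variable {R : Type u} [Ring R]

theorem isWeakFlat_of_projective (P : ModuleCat.{u} R) [Projective P] : IsWeakFlat P :=
  fun N _ => (tensorFunctor N).isZero_leftDerived_obj_projective_succ 0 P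

theorem isWeakInjective_of_injective (I : ModuleCat.{u} R) [Injective I] : IsWeakInjective I :=
  fun N _ => Abelian.Ext.subsingleton_of_injective N I 0

theorem homInto_exactAt_iff (T : ChainComplex (ModuleCat.{u} R) ℤ) (W : ModuleCat.{u} R)
    {a b c : ℤ} (hc : c + 1 = b) (hb : b + 1 = a) :
    (homInto T W).ExactAt b ↔ ∀ f : T.X b ⟶ W, T.d a b ≫ f = 0 →
      ∃ g : T.X c ⟶ W, T.d b c ≫ g = f := by
  rw [HomologicalComplex.exactAt_iff' _ c b a (by simp; lia) (by simp; lia),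
    ShortComplex.ab_exact_iff]
  rfl

theorem homFrom_exactAt_iff (T : CochainComplex (ModuleCat.{u} R) ℤ) (W : ModuleCat.{u} R)
    {a b c : ℤ} (hc : c + 1 = b) (hb : b + 1 = a) :
    (homFrom W T).ExactAt b ↔ ∀ f : W ⟶ T.X b, f ≫ T.d b a = 0 →
      ∃ g : W ⟶ T.X c, g ≫ T.d c b = f := by
  rw [HomologicalComplex.exactAt_iff' _ c b a (by simp; lia) (by simp; lia),
    ShortComplex.ab_exact_iff]
  rfl

theorem exactAt_iff_chain {C : Type*} [Category* C] [Abelian C] (T : ChainComplex C ℤ)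
    {a b c : ℤ} (hc : c + 1 = b) (hb : b + 1 = a) : T.ExactAt b ↔ (T.sc' a b c).Exact :=
  T.exactAt_iff' a b c (by simp; lia) (by simp; lia)

theorem exactAt_iff_cochain {C : Type*} [Category* C] [Abelian C] (T : CochainComplex C ℤ)
    {a b c : ℤ} (hc : c + 1 = b) (hb : b + 1 = a) : T.ExactAt b ↔ (T.sc' c b a).Exact :=
  T.exactAt_iff' c b a (by simp; lia) (by simp; lia)

theorem copureExact_isWeakFlat_iff (T : ChainComplex (ModuleCat.{u} R) ℤ) :
    CopureExact IsWeakFlat T ↔ IsWFCopureExact T := by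
  constructor
  · intro h
    exact ⟨h.projective, fun i => (exactAt_iff_chain T (sub_add_cancel i 1) rfl).2
        (h.exact _ _ _ (sub_add_cancel i 1) rfl),
      fun W hW i => (homInto_exactAt_iff T W (sub_add_cancel i 1) rfl).2
        (h.copure W hW _ _ _ (sub_add_cancel i 1) rfl)⟩
  · intro h
    exact ⟨h.projective, fun a b c hc hb => (exactAt_iff_chain T hc hb).1 (h.exact b),
      fun W hW a b c hc hb => (homInto_exactAt_iff T W hc hb).1 (h.copure W hW b)⟩

/-- The condition `IsWeakInjective` on objects of the opposite category. -/
def IsOpWeakInjective (W : (ModuleCat.{u} R)ᵒᵖ) : Prop := IsWeakInjective W.unop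

theorem IsWIPureExact.copureExact_op {T : CochainComplex (ModuleCat.{u} R) ℤ}
    (h : IsWIPureExact T) : CopureExact (C := (ModuleCat.{u} R)ᵒᵖ) IsOpWeakInjective (opChain T) where
  projective i := by
    have := h.injective i
    exact inferInstanceAs (Projective (Opposite.op (T.X i)))
  exact a b c hc hb := ((exactAt_iff_cochain T hc hb).1 (h.exact b)).op
  copure W hW a b c hc hb f hf := by
    obtain ⟨g, hg⟩ := (homFrom_exactAt_iff T W.unop hc hb).1 (h.pure _ hW b) f.unop
      (congrArg Quiver.Hom.unop hf)
    exact ⟨g.op, congrArg Quiver.Hom.op hg⟩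

theorem CopureExact.isWIPureExact_unop {T : ChainComplex (ModuleCat.{u} R)ᵒᵖ ℤ}
    (h : CopureExact IsOpWeakInjective T) : IsWIPureExact (R := R) (unopCochain T) where
  injective i := by
    have := h.projective i
    exact inferInstanceAs (Injective (T.X i).unop)
  exact i := (exactAt_iff_cochain _ (sub_add_cancel i 1) rfl).2
    (h.exact _ _ _ (sub_add_cancel i 1) rfl).unop
  pure W hW i := (homFrom_exactAt_iff _ W (sub_add_cancel i 1) rfl).2 (fun f hf => by
    obtain ⟨g, hg⟩ := h.copure (Opposite.op W) hW _ _ _ (sub_add_cancel i 1) rfl f.op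
      (congrArg Quiver.Hom.op hf)
    exact ⟨g.unop, congrArg Quiver.Hom.unop hg⟩)

theorem IsGorensteinWeakProjective.isCopureSyzygy {M : ModuleCat.{u} R}
    (h : IsGorensteinWeakProjective M) : IsCopureSyzygy IsWeakFlat M := by
  obtain ⟨T, hT, ⟨e⟩⟩ := h
  exact ⟨T, (copureExact_isWeakFlat_iff T).2 hT, 1, 0, rfl, ⟨e.symm⟩⟩

theorem IsGorensteinWeakInjective.isCopureSyzygy_op {M : ModuleCat.{u} R}
    (h : IsGorensteinWeakInjective M) :
    IsCopureSyzygy (IsOpWeakInjective (R := R)) (Opposite.op M) := by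
  obtain ⟨T, hT, ⟨e⟩⟩ := h
  -- The definition gives $M$ as a cokernel, whereas a cokernel in the opposite category is a kernel
  -- here. Exactness in degrees $-1$ and $0$ identifies $\operatorname{Coker} d^{-2}$ with
  -- $\operatorname{Ker} d^0$.
  have h₁ := (exactAt_iff_cochain T (a := 0) (b := -1) (c := -2) rfl rfl).1 (hT.exact (-1))
  have h₂ := (exactAt_iff_cochain T (a := 1) (b := 0) (c := -1) rfl rfl).1 (hT.exact 0)
  have hS := exact_cokernel_desc h₂ (T.d_comp_d (-2) (-1) 0)
  have hmono : Mono (cokernel.desc (T.d (-2) (-1)) (T.d (-1) 0) (T.d_comp_d _ _ _)) :=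
    h₁.mono_cokernelDesc
  exact ⟨opChain T, hT.copureExact_op, 1, 0, rfl, ⟨cokernelOpOp (T.d 0 1) ≪≫
    (e ≪≫ @kernelIsoOfExact _ _ _ _ hS hmono).op⟩⟩

theorem HasGWPResolution.nonempty_tateResolution {M : ModuleCat.{u} R} {n : ℕ}
    (h : HasGWPResolution M n) : Nonempty (WFCopureTateResolution M) := by
  obtain ⟨G, ε, hε, hε', hG, hG', hz⟩ := h
  have hW : ∀ P : ModuleCat.{u} R, Projective P → IsWeakFlat P :=
    fun P _ => isWeakFlat_of_projective P
  have : Epi ε := (ModuleCat.epi_iff_surjective _).2 hε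
  have w : G.d 1 0 ≫ ε = 0 := by ext x; exact hε'.apply_apply_eq_zero x
  have hex : (ShortComplex.mk (G.d 1 0) ε w).Exact :=
    (ShortComplex.ShortExact.moduleCat_exact_iff_function_exact _).2 hε'
  have h₁ := (exists_hasCopureSyzygy_cokernel hW G
    (fun i => (ShortComplex.ShortExact.moduleCat_exact_iff_function_exact _).2 (hG i)) n
    (fun i hi => (hG' i hi).isCopureSyzygy) hz).of_iso (cokernelIsoOfExact _ hex)
  obtain ⟨P, π, T, t, hP, hT, ht, m, hm⟩ := h₁.exists_tate hW
  exact ⟨⟨hP.resolution, T, (copureExact_isWeakFlat_iff T).1 hT, t, ht, m, hm⟩⟩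

theorem HasGWICoresolution.nonempty_tateResolution {N : ModuleCat.{u} R} {n : ℕ}
    (h : HasGWICoresolution N n) : Nonempty (WIPureTateResolution N) := by
  obtain ⟨G, ε, hε, hε', hG, hG', hz⟩ := h
  have hW : ∀ P : (ModuleCat.{u} R)ᵒᵖ, Projective P → IsOpWeakInjective P :=
    fun P _ => isWeakInjective_of_injective P.unop
  have : Mono ε := (ModuleCat.mono_iff_injective _).2 hε
  have w : ε ≫ G.d 0 1 = 0 := by ext x; exact hε'.apply_apply_eq_zero x
  have hex : (ShortComplex.mk ε (G.d 0 1) w).Exact :=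
    (ShortComplex.ShortExact.moduleCat_exact_iff_function_exact _).2 hε'
  have := HasExt.standard (ModuleCat.{u} R)ᵒᵖ
  have h₁ := (exists_hasCopureSyzygy_cokernel hW (opChain G)
    (fun i => ((ShortComplex.ShortExact.moduleCat_exact_iff_function_exact
      (G.sc' i (i + 1) (i + 2))).2 (hG i)).op) n
    (fun i hi => (hG' i hi).isCopureSyzygy_op) (fun i hi => (hz i hi).op)).of_iso
    (cokernelOpOp (G.d 0 1) ≪≫ (kernelIsoOfExact _ hex).op)
  obtain ⟨P, π, T, t, hP, hT, ht, m, hm⟩ := h₁.exists_tate hW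
  exact ⟨⟨hP.unopResolution, unopCochain T, hT.isWIPureExact_unop, fun n => (t n).unop,
    fun n => congrArg Quiver.Hom.unop (ht n).symm, m, fun n hn => by
      have := hm n hn
      exact inferInstanceAs (IsIso (t n).unop)⟩⟩

/-! ### Dimension shifting for Hom complexes -/

theorem homFrom_exactAt_of_projective (P : ModuleCat.{u} R) [Projective P]
    {T : CochainComplex (ModuleCat.{u} R) ℤ} (hT : ∀ i, T.ExactAt i) (i : ℤ) :
    (homFrom P T).ExactAt i := by
  refine (homFrom_exactAt_iff T P (sub_add_cancel i 1) rfl).2 fun f hf => ?_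
  have h := (exactAt_iff_cochain T (sub_add_cancel i 1) rfl).1 (hT i)
  exact ⟨h.liftFromProjective f hf, h.liftFromProjective_comp f hf⟩

theorem homInto_exactAt_of_injective (I : ModuleCat.{u} R) [Injective I]
    {T : ChainComplex (ModuleCat.{u} R) ℤ} (hT : ∀ i, T.ExactAt i) (i : ℤ) :
    (homInto T I).ExactAt i := by
  refine (homInto_exactAt_iff T I (sub_add_cancel i 1) rfl).2 fun f hf => ?_
  have h := (exactAt_iff_chain T (sub_add_cancel i 1) rfl).1 (hT i)
  exact ⟨h.descToInjective f hf, h.comp_descToInjective f hf⟩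

/-- Functoriality of `homFrom` in the module. -/
def homFromMap {M M' : ModuleCat.{u} R} (f : M ⟶ M') (T : CochainComplex (ModuleCat.{u} R) ℤ) :
    homFrom M' T ⟶ homFrom M T :=
  (NatTrans.mapHomologicalComplex (preadditiveCoyoneda.map f.op) (ComplexShape.up ℤ)).app T

/-- Functoriality of `homInto` in the module. -/
def homIntoMap {N N' : ModuleCat.{u} R} (f : N ⟶ N') (T : ChainComplex (ModuleCat.{u} R) ℤ) :
    homInto T N ⟶ homInto T N' :=
  (NatTrans.mapHomologicalComplex (preadditiveYoneda.map f) (ComplexShape.down ℤ).symm).app T.op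

/-- `homFrom` sends isomorphisms to isomorphisms. -/
def homFromIso {M M' : ModuleCat.{u} R} (e : M ≅ M') (T : CochainComplex (ModuleCat.{u} R) ℤ) :
    homFrom M T ≅ homFrom M' T :=
  (NatIso.mapHomologicalComplex (preadditiveCoyoneda.mapIso e.symm.op) (ComplexShape.up ℤ)).app T

/-- `homInto` sends isomorphisms to isomorphisms. -/
def homIntoIso {N N' : ModuleCat.{u} R} (e : N ≅ N') (T : ChainComplex (ModuleCat.{u} R) ℤ) :
    homInto T N ≅ homInto T N' :=
  (NatIso.mapHomologicalComplex (preadditiveYoneda.mapIso e) (ComplexShape.down ℤ).symm).app T.op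

theorem homFrom_shortExact {K P M : ModuleCat.{u} R} {i : K ⟶ P} {p : P ⟶ M} {hip : i ≫ p = 0}
    (h : (ShortComplex.mk i p hip).ShortExact) {T : CochainComplex (ModuleCat.{u} R) ℤ}
    (hT : ∀ i, Injective (T.X i)) :
    ∃ w : homFromMap p T ≫ homFromMap i T = 0,
      (ShortComplex.mk (homFromMap p T) (homFromMap i T) w).ShortExact := by
  have w : homFromMap p T ≫ homFromMap i T = 0 := by
    ext n (f : M ⟶ T.X n)
    change i ≫ p ≫ f = 0
    rw [reassoc_of% hip, zero_comp]
  have := h.mono_f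
  have := h.epi_g
  refine ⟨w, HomologicalComplex.shortExact_of_degreewise_shortExact _ fun n =>
    { exact := ?_, mono_f := ?_, epi_g := ?_ }⟩
  · rw [ShortComplex.ab_exact_iff]
    intro (f : P ⟶ T.X n) (hf : i ≫ f = 0)
    exact ⟨h.exact.desc f hf, h.exact.g_desc f hf⟩
  · rw [AddCommGrpCat.mono_iff_injective]
    intro (f : M ⟶ T.X n) (g : M ⟶ T.X n) (hfg : p ≫ f = p ≫ g)
    exact (cancel_epi p).1 hfg
  · rw [AddCommGrpCat.epi_iff_surjective]
    intro (f : K ⟶ T.X n)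
    have := hT n
    exact ⟨Injective.factorThru f i, Injective.comp_factorThru f i⟩

theorem homInto_shortExact {N I L : ModuleCat.{u} R} {i : N ⟶ I} {p : I ⟶ L} {hip : i ≫ p = 0}
    (h : (ShortComplex.mk i p hip).ShortExact) {T : ChainComplex (ModuleCat.{u} R) ℤ}
    (hT : ∀ i, Projective (T.X i)) :
    ∃ w : homIntoMap i T ≫ homIntoMap p T = 0,
      (ShortComplex.mk (homIntoMap i T) (homIntoMap p T) w).ShortExact := by
  have w : homIntoMap i T ≫ homIntoMap p T = 0 := by
    apply HomologicalComplex.hom_ext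
    intro n
    apply AddCommGrpCat.hom_ext
    ext (f : T.X n ⟶ N)
    change (f ≫ i) ≫ p = 0
    rw [Category.assoc, hip, comp_zero]
  have := h.mono_f
  have := h.epi_g
  refine ⟨w, HomologicalComplex.shortExact_of_degreewise_shortExact _ fun n =>
    { exact := ?_, mono_f := ?_, epi_g := ?_ }⟩
  · rw [ShortComplex.ab_exact_iff]
    intro (f : T.X n ⟶ I) (hf : f ≫ p = 0)
    exact ⟨h.exact.lift f hf, h.exact.lift_f f hf⟩
  · rw [AddCommGrpCat.mono_iff_injective]
    intro (f : T.X n ⟶ N) (g : T.X n ⟶ N) (hfg : f ≫ i = g ≫ i)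
    exact (cancel_mono i).1 hfg
  · rw [AddCommGrpCat.epi_iff_surjective]
    intro (f : T.X n ⟶ L)
    have := hT n
    exact ⟨Projective.factorThru (P := T.X n) f p, Projective.factorThru_comp (P := T.X n) f p⟩

/-- In the long exact sequence of
$0\to\operatorname{Hom}(M,T)\to\operatorname{Hom}(P,T)\to\operatorname{Hom}(K,T)\to 0$ the middle
complex is acyclic, so the connecting map is an isomorphism. -/
theorem homFrom_homology_shift {K P M : ModuleCat.{u} R} {i : K ⟶ P} {p : P ⟶ M}
    {hip : i ≫ p = 0} (h : (ShortComplex.mk i p hip).ShortExact) (hP : Projective P)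
    {T : CochainComplex (ModuleCat.{u} R) ℤ} (hT : ∀ i, Injective (T.X i))
    (hT' : ∀ i, T.ExactAt i) {j k : ℤ} (hk : j + 1 = k) :
    Nonempty ((homFrom K T).homology j ≅ (homFrom M T).homology k) := by
  obtain ⟨w, hS⟩ := homFrom_shortExact h hT
  exact ⟨hS.δIso j k hk (homFrom_exactAt_of_projective P hT' j).isZero_homology
    (homFrom_exactAt_of_projective P hT' k).isZero_homology⟩

theorem homInto_homology_shift {N I L : ModuleCat.{u} R} {i : N ⟶ I} {p : I ⟶ L}
    {hip : i ≫ p = 0} (h : (ShortComplex.mk i p hip).ShortExact) (hI : Injective I)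
    {T : ChainComplex (ModuleCat.{u} R) ℤ} (hT : ∀ i, Projective (T.X i))
    (hT' : ∀ i, T.ExactAt i) {j k : ℤ} (hk : j + 1 = k) :
    Nonempty ((homInto T L).homology j ≅ (homInto T N).homology k) := by
  obtain ⟨w, hS⟩ := homInto_shortExact h hT
  exact ⟨hS.δIso j k hk (homInto_exactAt_of_injective I hT' j).isZero_homology
    (homInto_exactAt_of_injective I hT' k).isZero_homology⟩

/-! ### Balance of Tate cohomology -/

/-- If a group `A` is identified with the cycles of `S`, then the homology of `S` is the quotient
of `A` by the elements that correspond to boundaries. -/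
theorem nonempty_homology_addEquiv (S : ShortComplex AddCommGrpCat.{u}) {A : Type u}
    [AddCommGroup A] (ι : A →+ S.X₂) (hg : ∀ a, S.g (ι a) = 0)
    (hg' : ∀ x : S.X₂, S.g x = 0 → ∃ a, ι a = x) (B : AddSubgroup A)
    (hB : ∀ a, a ∈ B ↔ ∃ x, S.f x = ι a) :
    Nonempty (S.homology ≅ AddCommGrpCat.of (A ⧸ B)) := by
  let ψ : A →+ (AddMonoidHom.ker S.g.hom ⧸ AddMonoidHom.range S.abToCycles) :=
    (QuotientAddGroup.mk' _).comp (ι.codRestrict (AddMonoidHom.ker S.g.hom) hg)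
  have hψ : Function.Surjective ψ := by
    intro y
    obtain ⟨⟨x, hx⟩, rfl⟩ := QuotientAddGroup.mk'_surjective _ y
    obtain ⟨a, rfl⟩ := hg' x hx
    exact ⟨a, rfl⟩
  have hB' : B = ψ.ker := by
    ext a
    rw [hB, AddMonoidHom.mem_ker]
    change _ ↔ QuotientAddGroup.mk' _ _ = 0
    rw [QuotientAddGroup.mk'_apply, QuotientAddGroup.eq_zero_iff]
    exact ⟨fun ⟨x, hx⟩ => ⟨x, Subtype.ext hx⟩, fun ⟨x, hx⟩ => ⟨x, congrArg Subtype.val hx⟩⟩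
  exact ⟨S.abHomologyIso ≪≫ ((QuotientAddGroup.quotientAddEquivOfEq hB').trans
    (QuotientAddGroup.quotientKerEquivOfSurjective ψ hψ)).toAddCommGrpIso.symm⟩

/-- With `K` the cokernel and `Z` the kernel, the cocycles on either side are
$\operatorname{Hom}(K,Z)$. The boundaries are the maps that extend along `K → T.X (a - 1)` on one
side and those that lift along `T'.X (b - 1) → Z` on the other, and these conditions agree. -/
theorem tate_balance_syzygies {T : ChainComplex (ModuleCat.{u} R) ℤ}
    {T' : CochainComplex (ModuleCat.{u} R) ℤ} (hT : ∀ i, Projective (T.X i))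
    (hT' : ∀ i, Injective (T'.X i)) (hTe : ∀ i, T.ExactAt i) (hTe' : ∀ i, T'.ExactAt i)
    {a a₁ b b₁ : ℤ} (ha : a + 1 = a₁) (hb : b + 1 = b₁) :
    Nonempty ((homInto T (kernel (T'.d b b₁))).homology a ≅
      (homFrom (cokernel (T.d a₁ a)) T').homology b) := by
  obtain ⟨a₀, ha₀⟩ : ∃ a₀, a₀ + 1 = a := ⟨a - 1, sub_add_cancel a 1⟩
  obtain ⟨b₀, hb₀⟩ : ∃ b₀, b₀ + 1 = b := ⟨b - 1, sub_add_cancel b 1⟩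
  let K := cokernel (T.d a₁ a)
  let Z := kernel (T'.d b b₁)
  let B : AddSubgroup (K ⟶ Z) :=
    { carrier := {f | ∃ g : K ⟶ T'.X b₀, g ≫ T'.d b₀ b = f ≫ kernel.ι _}
      zero_mem' := ⟨0, by simp⟩
      add_mem' := by
        rintro f f' ⟨g, hg⟩ ⟨g', hg'⟩
        exact ⟨g + g', by simp [hg, hg']⟩
      neg_mem' := by
        rintro f ⟨g, hg⟩
        exact ⟨-g, by simp [hg]⟩ }
  have hX := hT a₀
  have hI := hT' b₀
  have h := (exactAt_iff_chain T ha₀ ha).1 (hTe a)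
  have h' := (exactAt_iff_cochain T' hb₀ hb).1 (hTe' b)
  -- A lift `K → T'.X b₀` extends to `T.X a₀` because its target is injective and `T` is exact; an
  -- extension `T.X a₀ → Z` lifts to `T'.X b₀` because its source is projective and `T'` is exact.
  have hB : ∀ f : K ⟶ Z, f ∈ B ↔ ∃ g : T.X a₀ ⟶ Z, T.d a a₀ ≫ g = cokernel.π _ ≫ f := by
    intro f
    constructor
    · rintro ⟨g, hg⟩
      have hz : T.d a₁ a ≫ cokernel.π _ ≫ g = 0 := by simp
      let k : T.X a₀ ⟶ T'.X b₀ := h.descToInjective (cokernel.π _ ≫ g) hz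
      have hk : T.d a a₀ ≫ k = cokernel.π _ ≫ g := h.comp_descToInjective _ _
      refine ⟨k ≫ kernel.lift _ (T'.d b₀ b) (by simp), ?_⟩
      rw [← cancel_mono (kernel.ι _)]
      simp only [Category.assoc, kernel.lift_ι]
      rw [reassoc_of% hk, hg]
    · rintro ⟨g, hg⟩
      have hz : (g ≫ kernel.ι _) ≫ T'.d b b₁ = 0 := by simp
      let k : T.X a₀ ⟶ T'.X b₀ := h'.liftFromProjective (g ≫ kernel.ι _) hz
      have hk : k ≫ T'.d b₀ b = g ≫ kernel.ι _ := h'.liftFromProjective_comp _ _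
      refine ⟨cokernel.desc _ (T.d a a₀) (by simp) ≫ k, ?_⟩
      rw [← cancel_epi (cokernel.π _)]
      simp only [Category.assoc, cokernel.π_desc_assoc]
      rw [hk, reassoc_of% hg]
  obtain ⟨e⟩ := nonempty_homology_addEquiv ((homInto T Z).sc' a₀ a a₁) (A := K ⟶ Z)
    (AddMonoidHom.mk' (fun f => cokernel.π _ ≫ f) (fun f g => Preadditive.comp_add _ _ _ _ _ _))
    (fun f => by
      change T.d a₁ a ≫ cokernel.π _ ≫ f = 0
      simp)
    (fun f hf => ⟨cokernel.desc _ f hf, cokernel.π_desc (T.d a₁ a) f hf⟩) B hB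
  obtain ⟨e'⟩ := nonempty_homology_addEquiv ((homFrom K T').sc' b₀ b b₁) (A := K ⟶ Z)
    (AddMonoidHom.mk' (fun f => f ≫ kernel.ι _) (fun f g => Preadditive.add_comp _ _ _ _ _ _))
    (fun f => by
      change (f ≫ kernel.ι _) ≫ T'.d b b₁ = 0
      simp)
    (fun f hf => ⟨kernel.lift _ f hf, kernel.lift_ι (T'.d b b₁) f hf⟩) B (fun f => Iff.rfl)
  exact ⟨ShortComplex.homologyMapIso
      ((homInto T Z).isoSc' a₀ a a₁ (by simp; lia) (by simp; lia)) ≪≫ e ≪≫ e'.symm ≪≫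
    (ShortComplex.homologyMapIso
      ((homFrom K T').isoSc' b₀ b b₁ (by simp; lia) (by simp; lia))).symm⟩

/-- Consecutive cokernels of `T` are syzygies of one another, in negative degrees too. This reaches
the cokernel in degree `i - n`, which may be too low for `T` to agree with the projective
resolution. -/
theorem homFrom_homology_syzygy (T : ChainComplex (ModuleCat.{u} R) ℤ)
    (hT : ∀ i, Projective (T.X i)) (hTe : ∀ i, T.ExactAt i)
    {T' : CochainComplex (ModuleCat.{u} R) ℤ}
    (hT' : ∀ i, Injective (T'.X i)) (hTe' : ∀ i, T'.ExactAt i) (s : ℕ) {a a₁ b b₁ j k : ℤ}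
    (ha : a + 1 = a₁) (hb : b + 1 = b₁) (hab : b = a + s) (hjk : k = j + s) :
    Nonempty ((homFrom (cokernel (T.d b₁ b)) T').homology j ≅
      (homFrom (cokernel (T.d a₁ a)) T').homology k) := by
  induction s generalizing b b₁ j with
  | zero =>
    obtain rfl : b = a := by simpa using hab
    obtain rfl : k = j := by simpa using hjk
    subst ha hb
    exact ⟨Iso.refl _⟩
  | succ s ih =>
    obtain ⟨c, rfl⟩ : ∃ c, c + 1 = b := ⟨b - 1, sub_add_cancel b 1⟩
    obtain ⟨e⟩ := ih (b := c) (b₁ := c + 1) (j := j + 1) rfl (by push_cast at hab; lia)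
      (by push_cast at hjk; lia)
    obtain ⟨e'⟩ := homFrom_homology_shift
      (shortExact_cokernel_desc ((exactAt_iff_chain T rfl hb).1 (hTe (c + 1)))) (hT c) hT' hTe'
      (rfl : j + 1 = j + 1)
    exact ⟨e' ≪≫ e⟩

theorem shortExact_kernel_lift {C : Type*} [Category* C] [Abelian C] {S : ShortComplex C}
    (hS : S.Exact) : (ShortComplex.mk (kernel.ι S.f) (kernel.lift S.g S.f S.zero)
      (by rw [← cancel_mono (kernel.ι S.g)]; simp)).ShortExact := by
  have : Epi (kernel.lift S.g S.f S.zero) := hS.epi_kernelLift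
  refine { exact := ?_ }
  refine ShortComplex.exact_of_f_is_kernel _ ?_
  refine KernelFork.IsLimit.ofι _ _
    (fun f hf => kernel.lift S.f f (by simpa using hf =≫ kernel.ι S.g)) (fun f hf => by simp)
    (fun f hf m hm => by rw [← cancel_mono (kernel.ι S.f)]; simpa using hm)

theorem homFrom_homology_projectiveResolution {M : ModuleCat.{u} R} (P : ProjectiveResolution M)
    {T : CochainComplex (ModuleCat.{u} R) ℤ} (hT : ∀ i, Injective (T.X i))
    (hTe : ∀ i, T.ExactAt i) (m : ℕ) {j k : ℤ} (hjk : j + m = k) :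
    Nonempty ((homFrom (cokernel (P.complex.d (m + 1) m)) T).homology j ≅
      (homFrom M T).homology k) := by
  induction m generalizing j with
  | zero =>
    obtain rfl : j = k := by simpa using hjk
    exact ⟨(HomologicalComplex.homologyFunctor _ _ j).mapIso (homFromIso
      ((cokernelIsCokernel _).coconePointUniqueUpToIso P.isColimitCokernelCofork) T)⟩
  | succ m ih =>
    obtain ⟨e⟩ := ih (j := j + 1) (by push_cast at hjk; lia)
    obtain ⟨e'⟩ := homFrom_homology_shift (shortExact_cokernel_desc (P.exact_succ m))
      (P.projective m) hT hTe (rfl : j + 1 = j + 1)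
    exact ⟨e' ≪≫ e⟩

theorem homInto_homology_injectiveResolution {N : ModuleCat.{u} R} (E : InjectiveResolution N)
    {T : ChainComplex (ModuleCat.{u} R) ℤ} (hT : ∀ i, Projective (T.X i))
    (hTe : ∀ i, T.ExactAt i) (n : ℕ) {j k : ℤ} (hjk : j + n = k) :
    Nonempty ((homInto T (kernel (E.cocomplex.d n (n + 1)))).homology j ≅
      (homInto T N).homology k) := by
  induction n generalizing j with
  | zero =>
    obtain rfl : j = k := by simpa using hjk
    exact ⟨(HomologicalComplex.homologyFunctor _ _ j).mapIso (homIntoIso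
      (IsLimit.conePointUniqueUpToIso (kernelIsKernel _) E.isLimitKernelFork) T)⟩
  | succ n ih =>
    obtain ⟨e⟩ := ih (j := j + 1) (by push_cast at hjk; lia)
    obtain ⟨e'⟩ := homInto_homology_shift (shortExact_kernel_lift (E.exact_succ n))
      (E.injective n) hT hTe (rfl : j + 1 = j + 1)
    exact ⟨e' ≪≫ e⟩

theorem nonempty_tateExt_iso {M N : ModuleCat.{u} R} (τ : WFCopureTateResolution M)
    (ρ : WIPureTateResolution N) (i : ℤ) : Nonempty (tateExtGWP τ N i ≅ tateExtGWI M ρ i) := by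
  have hT := τ.copureExact.projective
  have hTe := τ.copureExact.exact
  have hT' := ρ.pureExact.injective
  have hTe' := ρ.pureExact.exact
  obtain ⟨n, hn⟩ := ρ.eventually_isIso
  obtain ⟨m₀, hm₀⟩ := τ.eventually_isIso
  -- The degree `m` must lie in the range where `T` and `P` agree and be at least `i - n`, so that
  -- the cokernel of `T` in degree `m` is an `s`-fold syzygy, with `s ≥ 0`, of the one in degree `i
  -- - n`.
  obtain ⟨m, s, hm, hs⟩ : ∃ m s : ℕ, m₀ ≤ m ∧ (m : ℤ) = i - n + s :=
    ⟨m₀ + i.toNat, (m₀ + i.toNat - i + n).toNat, by lia, by lia⟩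
  have := hm₀ m hm
  have := hm₀ (m + 1) (by lia)
  have := hn n le_rfl
  have := hn (n + 1) (by lia)
  let eP : cokernel (τ.T.d ((m + 1 : ℕ) : ℤ) (m : ℤ)) ≅ cokernel (τ.P.complex.d (m + 1) m) :=
    cokernel.mapIso _ _ (asIso (τ.u (m + 1))) (asIso (τ.u m)) (τ.comm m).symm
  let eE : kernel (ρ.E.cocomplex.d n (n + 1)) ≅ kernel (ρ.T.d (n : ℤ) ((n + 1 : ℕ) : ℤ)) :=
    kernel.mapIso _ _ (asIso (ρ.u n)) (asIso (ρ.u (n + 1))) (ρ.comm n).symm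
  obtain ⟨e₁⟩ := homInto_homology_injectiveResolution ρ.E hT hTe n (sub_add_cancel i n)
  obtain ⟨e₂⟩ := tate_balance_syzygies hT hT' hTe hTe' (a := i - n) (b := n)
    (b₁ := (n + 1 : ℕ)) rfl (by simp)
  obtain ⟨e₃⟩ := homFrom_homology_syzygy τ.T hT hTe hT' hTe' s (a := i - n) (b := m)
    (b₁ := (m + 1 : ℕ)) (j := i - m) (k := n) rfl (by simp) hs (by lia)
  obtain ⟨e₄⟩ := homFrom_homology_projectiveResolution τ.P hT' hTe' m (sub_add_cancel i m)
  -- The degrees along the chain are `i`, `i - n`, `i - n` for $\operatorname{Hom}(\mathbf T,-)$ and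
  -- then `n`, `i - m`, `i - m`, `i` for $\operatorname{Hom}(-,\mathbf T')$.
  exact ⟨e₁.symm ≪≫ (HomologicalComplex.homologyFunctor _ _ _).mapIso (homIntoIso eE τ.T) ≪≫
    e₂ ≪≫ e₃.symm ≪≫ (HomologicalComplex.homologyFunctor _ _ _).mapIso (homFromIso eP ρ.T) ≪≫ e₄⟩

end

end GorensteinWeak

theorem theorem5 {R : Type u} [Ring R] (M N : ModuleCat.{u} R)
    (hM : GorensteinWeak.gwpd M < ⊤) (hN : GorensteinWeak.gwid N < ⊤) :
    Nonempty (GorensteinWeak.WFCopureTateResolution M) ∧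
    Nonempty (GorensteinWeak.WIPureTateResolution N) ∧
    ∀ (τ : GorensteinWeak.WFCopureTateResolution M) (ρ : GorensteinWeak.WIPureTateResolution N)
      (i : ℤ),
      Nonempty (GorensteinWeak.tateExtGWP τ N i ≅ GorensteinWeak.tateExtGWI M ρ i) := by
  refine ⟨?_, ?_, GorensteinWeak.nonempty_tateExt_iso⟩
  · obtain ⟨n, hn⟩ := iInf_lt_iff.1 hM
    obtain ⟨h, -⟩ := iInf_lt_iff.1 hn
    exact h.nonempty_tateResolution
  · obtain ⟨n, hn⟩ := iInf_lt_iff.1 hN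
    obtain ⟨h, -⟩ := iInf_lt_iff.1 hn
    exact h.nonempty_tateResolution
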